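/- Let $\mathcal U$ be a unital of even order $n\ge 4$, i.e. a $2$-$(n^3+1,n+1,1)$ design whose blocks are called lines, satisfying Wilbrink's conditions: (I) $\mathcal U$ contains no O'Nan configuration, i.e. no four distinct lines intersecting in six distinct points. (II) If $x$ is a point, $L$ a line through $x$, and $M$ a line missing $x$ which meets $L$, then for every point $y'\in L\setminus\{x\}$ there is a line $M'$ through $y'$ but not through $x$ which meets all the lines through $x$ that meet $M$. For a point $x$, two lines $M,M'$ missing $x$ are $x$-parallel, written $M\parallel_x M'$, if they meet the same lines through $x$. Let $\mathcal I(x)$ be the inversive plane of order $n$ whose points are the lines through $x$ and a symbol $\infty_x$, and whose circles are - the $\parallel_x$-classes of lines missing $x$, where the class of $M$ is incident with exactly the lines through $x$ that meet $M$ (and not with $\infty_x$); - the sets $C_x(K,K')\cup\{\infty_x\}$ for distinct lines $K,K'$ through $x$, where $C_x(K,K')$ consists of $K$, $K'$ and all lines $K''$ through $x$ such that no line missing $x$ meets $K$, $K'$ and $K''$. A flock of $\mathcal I(x)$ with carriers $p\ne q$ is a set of mutually disjoint circles partitioning the set of all points other than $p,q$; it exists and is uniquely determined by $p,q$. For each line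 $L$ pick a point $x_L$ on $L$, arbitrarily. The special spread $\mathcal S_L$ of $L$ consists of $L$ and of all the lines in the $\parallel_{x_L}$-classes which are the circles of the flock of $\mathcal I(x_L)$ with carriers $L$ and $\infty_{x_L}$ (it does not depend on the choice of $x_L$). Put $\mathcal S^*_L=\mathcal S_L\setminus\{L\}$. Three distinct lines $L,M,N$ form a self-polar triangle if $\{L,M,N\}=\mathcal S_L\cap\mathcal S_M=\mathcal S_L\cap\mathcal S_N=\mathcal S_M\cap\mathcal S_N$. **Theorem.** Let $L,M,N$ be pairwise disjoint lines of $\mathcal U$. Then the following are equivalent. 1. $L,M,N$ form a self-polar triangle. 2. $L\parallel_z M$ for every point $z\in N$. 3. Every line meeting two of $L,M,N$ meets all of $L,M,N$. 4. $M\in\mathcal S^*_L$, and there exist distinct points $z_1,z_2\in N$ such that $L\parallel_{z_1}M$ and $L\parallel_{z_2}M$. -/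

import Mathlib

/-- A unital of order `n` on the point set `P`: a `2`-`(n ^ 3 + 1, n + 1, 1)` design, whose blocks
are called lines. -/
structure Unital (P : Type*) (n : ℕ) where
  lines : Set (Set P)
  card_points : Nat.card P = n ^ 3 + 1
  card_line : ∀ L ∈ lines, L.ncard = n + 1
  existsUnique_line : ∀ p q : P, p ≠ q → ∃! L : Set P, L ∈ lines ∧ p ∈ L ∧ q ∈ L

namespace Unital

variable {P : Type*} {n : ℕ}

/-- Four distinct lines form an O'Nan configuration if they intersect in six distinct points, that
is, any two of them meet and no three of them are concurrent. -/
def IsONan (U : Unital P n) (K : Fin 4 → Set P) : Prop :=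
  Function.Injective K ∧ (∀ i, K i ∈ U.lines) ∧
    (∀ i j, i ≠ j → (K i ∩ K j).Nonempty) ∧
    ∀ i j k, i ≠ j → i ≠ k → j ≠ k → K i ∩ K j ∩ K k = ∅

/-- Wilbrink's condition (I): there are no O'Nan configurations. -/
def ConditionI (U : Unital P n) : Prop :=
  ¬ ∃ K : Fin 4 → Set P, U.IsONan K

/-- Wilbrink's condition (II): if `L` is a line through `x`, `M` is a line missing `x` that meets
`L`, and `y` is a point of `L` other than `x`, then some line through `y` but not through `x` meets
all the lines through `x` that meet `M`. -/
def ConditionII (U : Unital P n) : Prop :=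
  ∀ (x : P), ∀ L ∈ U.lines, ∀ M ∈ U.lines, x ∈ L → x ∉ M → (L ∩ M).Nonempty →
    ∀ y ∈ L, y ≠ x → ∃ M' ∈ U.lines, y ∈ M' ∧ x ∉ M' ∧
      ∀ K ∈ U.lines, x ∈ K → (K ∩ M).Nonempty → (K ∩ M').Nonempty

/-- `x`-parallelism of two lines missing `x`: they meet the same lines through `x`. -/
def Parallel (U : Unital P n) (x : P) (M M' : Set P) : Prop :=
  (M ∈ U.lines ∧ x ∉ M) ∧ (M' ∈ U.lines ∧ x ∉ M') ∧
    ∀ K ∈ U.lines, x ∈ K → ((K ∩ M).Nonempty ↔ (K ∩ M').Nonempty)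

/-- The lines of the unital through `x`. -/
def Pencil (U : Unital P n) (x : P) : Type _ :=
  {K : Set P // K ∈ U.lines ∧ x ∈ K}

/-- The points of the inversive plane at `x`: the lines `K` through `x` (as `some K`) and one
further point `∞` (as `none`). -/
abbrev InvPoint (U : Unital P n) (x : P) : Type _ :=
  Option (U.Pencil x)

/-- The circle determined by a line `M` missing `x`, as a point set: the lines through `x` which
meet `M`. Two lines missing `x` determine the same circle if and only if they are `x`-parallel, so
these circles are the `x`-parallel classes. -/
def circleOf (U : Unital P n) (x : P) (M : Set P) : Set (U.InvPoint x) :=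
  some '' {K : U.Pencil x | (K.1 ∩ M).Nonempty}

/-- For lines `L`, `L'` through `x`: the set consisting of `L`, `L'` and of all the lines `L''`
through `x` such that no line missing `x` meets `L`, `L'` and `L''`. -/
def blockOf (U : Unital P n) (x : P) (L L' : U.Pencil x) : Set (U.Pencil x) :=
  {L, L'} ∪ {L'' | ¬ ∃ M ∈ U.lines, x ∉ M ∧
    (M ∩ L.1).Nonempty ∧ (M ∩ L'.1).Nonempty ∧ (M ∩ L''.1).Nonempty}

/-- The circles (as point sets) of the inversive plane at `x`: those given by the lines missing
`x`, and those of the form `blockOf x L L' ∪ {∞}` with `L ≠ L'`. -/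
def circles (U : Unital P n) (x : P) : Set (Set (U.InvPoint x)) :=
  {C | ∃ M ∈ U.lines, x ∉ M ∧ C = U.circleOf x M} ∪
    {C | ∃ L L' : U.Pencil x, L ≠ L' ∧ C = insert none (some '' U.blockOf x L L')}

/-- A flock with carriers `p`, `q` of the inversive plane at `x`: a set of mutually disjoint circles
that partition the set of all points other than `p` and `q`. -/
structure IsFlock (U : Unital P n) (x : P) (p q : U.InvPoint x)
    (F : Set (Set (U.InvPoint x))) : Prop where
  carriers_ne : p ≠ q
  subset_circles : F ⊆ U.circles x
  disjoint : ∀ C ∈ F, ∀ D ∈ F, C ≠ D → Disjoint C D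
  sUnion_eq : ⋃₀ F = {p, q}ᶜ

/-- The special spread of the line `L`, constructed at the point `x` of `L`: the line `L`, together
with all the lines in those `x`-parallel classes that are the circles of the flock with carriers
`L` and `∞` of the inversive plane at `x`. -/
def specialSpread (U : Unital P n) (x : P) (L : Set P) : Set (Set P) :=
  {L} ∪ {M | M ∈ U.lines ∧ x ∉ M ∧ ∃ (hL : L ∈ U.lines ∧ x ∈ L) (F : Set (Set (U.InvPoint x))),
    U.IsFlock x (some ⟨L, hL⟩) none F ∧ U.circleOf x M ∈ F}

/-- `L`, `M`, `N` form a self-polar triangle: they are three distinct lines, and `{L, M, N}` is the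
intersection of any two of their special spreads. Here the special spread of a line `K` is
constructed at the chosen point `pick K` of `K`. -/
def IsSelfPolarTriangle (U : Unital P n) (pick : Set P → P) (L M N : Set P) : Prop :=
  (L ∈ U.lines ∧ M ∈ U.lines ∧ N ∈ U.lines) ∧ (L ≠ M ∧ L ≠ N ∧ M ≠ N) ∧
    {L, M, N} = U.specialSpread (pick L) L ∩ U.specialSpread (pick M) M ∧
    {L, M, N} = U.specialSpread (pick L) L ∩ U.specialSpread (pick N) N ∧
    {L, M, N} = U.specialSpread (pick M) M ∩ U.specialSpread (pick N) N

end Unital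

/-! Call two disjoint lines conjugate (`Conj`) if they are parallel with respect to at least two
points. This relation is symmetric and mentions no base point, and `specialSpread_eq` shows that it
describes the special spreads: `M` lies in the special spread of `L`, and differs from `L`, exactly
when `L` and `M` are conjugate.

The bridge is geometry in an inversive plane of even order. A circle `C` and a point `p` off it
determine a unique `q` such that all circles through `p` and `q` are tangent to `C`, and two such
tangents already suffice (`isNucleus_of_two_tangents`). The flock with carriers `p`, `q` is the set
of circles with this property. In the plane at `x ∈ L`, the circle of `M` is tangent to a circle
through `L` and `∞` at `B` exactly when some point of `B` is a centre of parallelism of `L` and `M`.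
Hence two centres put `M` in the flock (`isNucleus_circleOf_iff_conj`).

The centres of conjugate lines `L`, `M` are then exactly the points of a third line `J`, conjugate
to both (`Conj.exists_polar`), and a count shows that `J` is the only line conjugate to both
(`Conj.eq_of_conj`). Each of the four conditions says that `N` is this `J`. -/

section Counting

/-! ### Counting and parity over partitions. -/

variable {α ι : Type*} [Finite ι]

theorem ncard_eq_sum_ncard_of_existsUnique [Finite α] {S : Set α} {T : Set ι} {r : ι → α → Prop}
    (h : ∀ a ∈ S, ∃! i, i ∈ T ∧ r i a) :
    S.ncard = ∑ i ∈ T.toFinite.toFinset, {a ∈ S | r i a}.ncard := by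
  classical
  have := Fintype.ofFinite α
  obtain rfl | ⟨a₀, ha₀⟩ := S.eq_empty_or_nonempty
  · simp
  have : Nonempty ι := ⟨(h a₀ ha₀).choose⟩
  choose! f hf hu using h
  rw [Set.ncard_eq_toFinset_card S,
    Finset.card_eq_sum_card_fiberwise (f := f) (t := T.toFinite.toFinset)
      (fun a ha => by simpa using (hf a (by simpa using ha)).1)]
  refine Finset.sum_congr rfl fun i hi => ?_
  rw [← Set.ncard_coe_finset]
  congr 1
  ext a
  simp only [Finset.coe_filter, Set.Finite.mem_toFinset, Set.mem_ofPred_eq]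
  constructor
  · rintro ⟨ha, rfl⟩
    exact ⟨ha, (hf a ha).2⟩
  · rintro ⟨ha, hr⟩
    exact ⟨ha, (hu a ha i ⟨by simpa using hi, hr⟩).symm⟩

theorem ncard_eq_mul_of_existsUnique [Finite α] {S : Set α} {T : Set ι} {r : ι → α → Prop} {k : ℕ}
    (h : ∀ a ∈ S, ∃! i, i ∈ T ∧ r i a) (hk : ∀ i ∈ T, {a ∈ S | r i a}.ncard = k) :
    S.ncard = T.ncard * k := by
  rw [ncard_eq_sum_ncard_of_existsUnique h,
    Finset.sum_congr rfl (fun i hi => hk i (by simpa using hi)), Finset.sum_const,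
    Set.ncard_eq_toFinset_card T, smul_eq_mul]

/-- Evenness of the order enters through this parity count: circles have `n + 1` points, and circles
with two points removed have `n - 1`, both odd. -/
theorem odd_ncard_of_existsUnique [Finite α] {S : Set α} {T : Set ι} {r : ι → α → Prop}
    (h : ∀ a ∈ S, ∃! i, i ∈ T ∧ r i a) (hS : Odd S.ncard) :
    Odd {i ∈ T | Odd {a ∈ S | r i a}.ncard}.ncard := by
  classical
  rw [ncard_eq_sum_ncard_of_existsUnique h, Finset.odd_sum_iff_odd_card_odd] at hS
  rw [← Set.ncard_coe_finset] at hS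
  simpa using hS

theorem exists_odd_of_existsUnique [Finite α] {S : Set α} {T : Set ι} {r : ι → α → Prop}
    (h : ∀ a ∈ S, ∃! i, i ∈ T ∧ r i a) (hS : Odd S.ncard) :
    ∃ i ∈ T, Odd {a ∈ S | r i a}.ncard := by
  have := (odd_ncard_of_existsUnique h hS).pos
  obtain ⟨i, hi⟩ := (Set.ncard_pos).1 this
  exact ⟨i, hi⟩

theorem surjOn_of_injOn_of_ncard_le {S : Set α} {T : Set ι} {f : α → ι}
    (hf : ∀ a ∈ S, f a ∈ T) (hi : Set.InjOn f S) (hc : T.ncard ≤ S.ncard) {i : ι} (h : i ∈ T) :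
    ∃ a ∈ S, f a = i := by
  have : f '' S = T := by
    apply Set.eq_of_subset_of_ncard_le
    · rintro _ ⟨a, ha, rfl⟩; exact hf a ha
    · rwa [hi.ncard_image]
    · exact T.toFinite
  rw [← this] at h
  exact h

theorem ncard_diff_pair {S : Set α} {a b : α} (ha : a ∈ S) (hb : b ∈ S) (hab : a ≠ b) :
    (S \ {a, b}).ncard = S.ncard - 2 := by
  rw [Set.ncard_sdiff (by rintro x (rfl | rfl) <;> assumption), Set.ncard_pair hab]

end Counting

/-- The circle axioms of a finite inversive plane of order `n`. -/
structure IsInversivePlane {X : Type*} (n : ℕ) (𝒞 : Set (Set X)) : Prop where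
  card_points : Nat.card X = n ^ 2 + 1
  card_circle : ∀ C ∈ 𝒞, C.ncard = n + 1
  existsUnique_circle : ∀ a b c : X, a ≠ b → a ≠ c → b ≠ c → ∃! C, C ∈ 𝒞 ∧ a ∈ C ∧ b ∈ C ∧ c ∈ C

/-! ### Tangency and nuclei in inversive planes of even order. -/

namespace IsInversivePlane

variable {X : Type*} {n : ℕ} {𝒞 : Set (Set X)}

/-- The circle `C` misses `p` and `q`, and every circle through `p` and `q` is tangent to `C`. -/
structure IsNucleus (𝒞 : Set (Set X)) (C : Set X) (p q : X) : Prop where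
  ne : p ≠ q
  left : p ∉ C
  right : q ∉ C
  tangent : ∀ D ∈ 𝒞, p ∈ D → q ∈ D → (C ∩ D).ncard = 1

theorem eq_of_mem (h : IsInversivePlane n 𝒞) {C D : Set X} (hC : C ∈ 𝒞) (hD : D ∈ 𝒞) {a b c : X}
    (hab : a ≠ b) (hac : a ≠ c) (hbc : b ≠ c) (haC : a ∈ C) (hbC : b ∈ C) (hcC : c ∈ C)
    (haD : a ∈ D) (hbD : b ∈ D) (hcD : c ∈ D) : C = D :=
  (h.existsUnique_circle a b c hab hac hbc).unique ⟨hC, haC, hbC, hcC⟩ ⟨hD, haD, hbD, hcD⟩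

theorem ncard_diff_singleton (h : IsInversivePlane n 𝒞) {C : Set X} (hC : C ∈ 𝒞) {p : X}
    (hp : p ∈ C) : (C \ {p}).ncard = n := by
  rw [Set.ncard_sdiff_singleton_of_mem hp, h.card_circle C hC]; omega

theorem existsUnique_circle_of_mem (h : IsInversivePlane n 𝒞) {C : Set X} {p q : X} (hpq : p ≠ q)
    (hp : p ∉ C) (hq : q ∉ C) :
    ∀ a ∈ C, ∃! D, D ∈ {D | D ∈ 𝒞 ∧ p ∈ D ∧ q ∈ D} ∧ a ∈ D := by
  intro a ha
  obtain ⟨D, hD, hu⟩ := h.existsUnique_circle p q a hpq (fun e => hp (e ▸ ha))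
    (fun e => hq (e ▸ ha))
  exact ⟨D, ⟨⟨hD.1, hD.2.1, hD.2.2.1⟩, hD.2.2.2⟩,
      fun E hE => hu E ⟨hE.1.1, hE.1.2.1, hE.1.2.2, hE.2⟩⟩

theorem IsNucleus.symm {C : Set X} {p q : X} (h : IsNucleus 𝒞 C p q) : IsNucleus 𝒞 C q p :=
  ⟨h.ne.symm, h.right, h.left, fun D hD hq hp => h.tangent D hD hp hq⟩

theorem IsNucleus.inter_eq {C D : Set X} {p q r : X} (hq : IsNucleus 𝒞 C p q) (hD : D ∈ 𝒞)
    (hpD : p ∈ D) (hqD : q ∈ D) (hrC : r ∈ C) (hrD : r ∈ D) : C ∩ D = {r} := by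
  obtain ⟨a, ha⟩ := Set.ncard_eq_one.1 (hq.tangent D hD hpD hqD)
  have : r ∈ C ∩ D := ⟨hrC, hrD⟩
  rw [ha] at this ⊢
  rw [Set.mem_singleton_iff.1 this]

theorem ncard_diff_pair (h : IsInversivePlane n 𝒞) {C : Set X} (hC : C ∈ 𝒞) {p q : X}
    (hpq : p ≠ q) (hp : p ∈ C) (hq : q ∈ C) : (C \ {p, q}).ncard = n - 1 := by
  rw [_root_.ncard_diff_pair hp hq hpq, h.card_circle C hC]; omega

variable [Finite X]

theorem ncard_inter_le (h : IsInversivePlane n 𝒞) {C D : Set X} (hC : C ∈ 𝒞) (hD : D ∈ 𝒞)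
    (hCD : C ≠ D) : (C ∩ D).ncard ≤ 2 := by
  by_contra! hlt
  obtain ⟨a, b, c, ha, hb, hc, hab, hac, hbc⟩ := (Set.two_lt_ncard_iff).1 hlt
  exact hCD (h.eq_of_mem hC hD hab hac hbc ha.1 hb.1 hc.1 ha.2 hb.2 hc.2)

theorem ncard_inter_eq_one (h : IsInversivePlane n 𝒞) {C D : Set X} (hC : C ∈ 𝒞) (hD : D ∈ 𝒞)
    (hCD : C ≠ D) (hodd : Odd (C ∩ D).ncard) : (C ∩ D).ncard = 1 := by
  have := h.ncard_inter_le hC hD hCD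
  interval_cases h : (C ∩ D).ncard
  · simp at hodd
  · rfl
  · exact absurd hodd (by decide)

theorem ncard_compl_pair (h : IsInversivePlane n 𝒞) {p q : X} (hpq : p ≠ q) :
    ({p, q}ᶜ : Set X).ncard = n ^ 2 - 1 := by
  rw [Set.ncard_compl, h.card_points, Set.ncard_pair hpq]; omega

theorem ncard_circles_through_pair (h : IsInversivePlane n 𝒞) (hn : 2 ≤ n) {p q : X}
    (hpq : p ≠ q) : {C | C ∈ 𝒞 ∧ p ∈ C ∧ q ∈ C}.ncard = n + 1 := by
  have := ncard_eq_mul_of_existsUnique (S := ({p, q}ᶜ : Set X))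
    (T := {C | C ∈ 𝒞 ∧ p ∈ C ∧ q ∈ C}) (r := fun C a => a ∈ C) (k := n - 1) ?_ ?_
  · rw [h.ncard_compl_pair hpq] at this
    have h2 : n ^ 2 - 1 = (n + 1) * (n - 1) := by
      obtain ⟨m, rfl⟩ : ∃ m, n = m + 1 := ⟨n - 1, by omega⟩
      simp only [Nat.add_sub_cancel]
      rw [show (m + 1) ^ 2 = (m + 1 + 1) * m + 1 by ring, Nat.add_sub_cancel]
    rw [h2] at this
    exact (Nat.eq_of_mul_eq_mul_right (by omega) this).symm
  · intro a ha
    simp only [Set.mem_compl_iff, Set.mem_insert_iff, Set.mem_singleton_iff, not_or] at ha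
    obtain ⟨C, hC, hu⟩ := h.existsUnique_circle p q a hpq (Ne.symm ha.1) (Ne.symm ha.2)
    exact ⟨C, ⟨⟨hC.1, hC.2.1, hC.2.2.1⟩, hC.2.2.2⟩,
      fun D hD => hu D ⟨hD.1.1, hD.1.2.1, hD.1.2.2, hD.2⟩⟩
  · rintro C ⟨hC, hp, hq⟩
    rw [← h.ncard_diff_pair hC hpq hp hq]
    congr 1
    ext a
    simp only [Set.mem_ofPred_eq, Set.mem_sdiff, Set.mem_compl_iff]
    tauto

theorem exists_ne_circle (h : IsInversivePlane n 𝒞) (hn : 2 ≤ n) {p q : X} (hpq : p ≠ q)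
    (D : Set X) : ∃ E ∈ 𝒞, p ∈ E ∧ q ∈ E ∧ E ≠ D := by
  obtain ⟨E, hE, hne⟩ := Set.exists_ne_of_one_lt_ncard
    (s := {C | C ∈ 𝒞 ∧ p ∈ C ∧ q ∈ C}) (by rw [h.ncard_circles_through_pair hn hpq]; omega) D
  exact ⟨E, hE.1, hE.2.1, hE.2.2, hne⟩

/-- Of the `n + 1` circles through `p` and `q`, exactly `n` pass through a second point of `C`, one
for each point of `C` other than `p`; one circle is left over. -/
theorem existsUnique_tangent (h : IsInversivePlane n 𝒞) (hn : 2 ≤ n) {C : Set X} (hC : C ∈ 𝒞)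
    {p q : X} (hp : p ∈ C) (hq : q ∉ C) :
    ∃! D, D ∈ 𝒞 ∧ p ∈ D ∧ q ∈ D ∧ C ∩ D = {p} := by
  have hpq : p ≠ q := fun e => hq (e ▸ hp)
  have key : ∀ s ∈ C \ {p}, ∃ D, D ∈ 𝒞 ∧ p ∈ D ∧ q ∈ D ∧ s ∈ D := by
    intro s hs
    obtain ⟨D, hD, -⟩ := h.existsUnique_circle p q s hpq (fun e => hs.2 e.symm)
      (fun e => hq (e ▸ hs.1))
    exact ⟨D, hD⟩
  choose! f hf using key
  have hinj : Set.InjOn f (C \ {p}) := by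
    intro s hs t ht hst
    by_contra hne
    have h1 := hf s hs
    have h2 := hf t ht
    rw [← hst] at h2
    have := h.eq_of_mem hC h1.1 (fun e => hs.2 e.symm) (fun e => ht.2 e.symm) hne hp hs.1 ht.1
      h1.2.1 h1.2.2.2 h2.2.2.2
    exact hq (this ▸ h1.2.2.1)
  have himg : f '' (C \ {p}) ⊆ {C | C ∈ 𝒞 ∧ p ∈ C ∧ q ∈ C} := by
    rintro _ ⟨s, hs, rfl⟩
    exact ⟨(hf s hs).1, (hf s hs).2.1, (hf s hs).2.2.1⟩
  have hcard : ({C | C ∈ 𝒞 ∧ p ∈ C ∧ q ∈ C} \ f '' (C \ {p})).ncard = 1 := by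
    rw [Set.ncard_sdiff himg, hinj.ncard_image, h.ncard_diff_singleton hC hp,
      h.ncard_circles_through_pair hn hpq]
    omega
  have hmem : ∀ D, (D ∈ 𝒞 ∧ p ∈ D ∧ q ∈ D ∧ C ∩ D = {p}) ↔
      D ∈ {C | C ∈ 𝒞 ∧ p ∈ C ∧ q ∈ C} \ f '' (C \ {p}) := by
    intro D
    constructor
    · rintro ⟨hD, hpD, hqD, hCD⟩
      refine ⟨⟨hD, hpD, hqD⟩, ?_⟩
      rintro ⟨s, hs, rfl⟩
      have : s ∈ C ∩ f s := ⟨hs.1, (hf s hs).2.2.2⟩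
      rw [hCD] at this
      exact hs.2 this
    · rintro ⟨⟨hD, hpD, hqD⟩, hne⟩
      refine ⟨hD, hpD, hqD, Set.Subset.antisymm ?_ (by rintro _ rfl; exact ⟨hp, hpD⟩)⟩
      rintro s ⟨hsC, hsD⟩
      by_contra hsp
      refine hne ⟨s, ⟨hsC, hsp⟩, ?_⟩
      have h1 := hf s ⟨hsC, hsp⟩
      exact h.eq_of_mem h1.1 hD hpq (fun e => hsp e.symm) (fun e => hq (e ▸ hsC)) h1.2.1 h1.2.2.1
        h1.2.2.2 hpD hqD hsD
  obtain ⟨D, hD⟩ := Set.ncard_eq_one.1 hcard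
  refine ⟨D, (hmem D).2 (by rw [hD]; rfl), fun E hE => ?_⟩
  have := (hmem E).1 hE
  rw [hD] at this
  exact this

/-- The circles through `p` and `q` partition the `n + 1` points of `C` into sets of size at most
two, so the odd parts are the tangencies. -/
theorem odd_ncard_tangents (h : IsInversivePlane n 𝒞) (he : Even n) {C : Set X} (hC : C ∈ 𝒞)
    {p q : X} (hpq : p ≠ q) (hp : p ∉ C) (hq : q ∉ C) :
    Odd {D | D ∈ 𝒞 ∧ p ∈ D ∧ q ∈ D ∧ (C ∩ D).ncard = 1}.ncard := by
  have := odd_ncard_of_existsUnique (h.existsUnique_circle_of_mem hpq hp hq)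
    (by rw [h.card_circle C hC]; exact he.add_one)
  convert this using 2
  ext D
  simp only [Set.mem_ofPred_eq]
  constructor
  · rintro ⟨hD, hpD, hqD, h1⟩
    refine ⟨⟨hD, hpD, hqD⟩, ?_⟩
    change Odd (C ∩ D).ncard
    rw [h1]; exact odd_one
  · rintro ⟨⟨hD, hpD, hqD⟩, h1⟩
    exact ⟨hD, hpD, hqD, h.ncard_inter_eq_one hC hD (fun e => hp (e ▸ hpD)) h1⟩

theorem exists_tangent_through (h : IsInversivePlane n 𝒞) (hn : 2 ≤ n) (he : Even n) {C : Set X}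
    (hC : C ∈ 𝒞) {p v : X} (hpv : p ≠ v) (hp : p ∉ C) :
    ∃ D ∈ 𝒞, p ∈ D ∧ v ∈ D ∧ (C ∩ D).ncard = 1 := by
  by_cases hv : v ∈ C
  · obtain ⟨D, hD, -⟩ := h.existsUnique_tangent hn hC hv hp
    exact ⟨D, hD.1, hD.2.2.1, hD.2.1, by rw [hD.2.2.2]; exact Set.ncard_singleton v⟩
  · obtain ⟨D, hD⟩ := (Set.ncard_pos).1 (h.odd_ncard_tangents he hC hpv hp hv).pos
    exact ⟨D, hD⟩

theorem eq_of_tangent (h : IsInversivePlane n 𝒞) (hn : 2 ≤ n) {C D E : Set X} (hC : C ∈ 𝒞)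
    (hD : D ∈ 𝒞) (hE : E ∈ 𝒞) {p u : X} (hp : p ∉ C) (hpD : p ∈ D) (hpE : p ∈ E) (hu : u ∈ C)
    (huD : u ∈ D) (huE : u ∈ E) (h1 : (C ∩ D).ncard = 1) (h2 : (C ∩ E).ncard = 1) : D = E := by
  have aux : ∀ {D : Set X}, u ∈ D → (C ∩ D).ncard = 1 → C ∩ D = {u} := by
    intro D huD h1
    obtain ⟨a, ha⟩ := Set.ncard_eq_one.1 h1
    have : u ∈ C ∩ D := ⟨hu, huD⟩
    rw [ha] at this ⊢
    rw [Set.mem_singleton_iff.1 this]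
  exact (h.existsUnique_tangent hn hC hu hp).unique ⟨hD, huD, hpD, aux huD h1⟩
    ⟨hE, huE, hpE, aux huE h2⟩

theorem ncard_tangents_through_point (h : IsInversivePlane n 𝒞) (hn : 2 ≤ n) {C : Set X}
    (hC : C ∈ 𝒞) {p : X} (hp : p ∉ C) :
    {D | D ∈ 𝒞 ∧ p ∈ D ∧ (C ∩ D).ncard = 1}.ncard = n + 1 := by
  have := ncard_eq_mul_of_existsUnique (S := C)
    (T := {D | D ∈ 𝒞 ∧ p ∈ D ∧ (C ∩ D).ncard = 1}) (r := fun D a => a ∈ D) (k := 1) ?_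
    (fun D hD => hD.2.2)
  · rw [h.card_circle C hC, mul_one] at this
    exact this.symm
  · intro a ha
    obtain ⟨D, hD, -⟩ := h.existsUnique_tangent hn hC ha hp
    have h1 : (C ∩ D).ncard = 1 := by rw [hD.2.2.2]; exact Set.ncard_singleton a
    exact ⟨D, ⟨⟨hD.1, hD.2.2.1, h1⟩, hD.2.1⟩, fun E hE =>
      h.eq_of_tangent hn hC hE.1.1 hD.1 hp hE.1.2.1 hD.2.2.1 ha hE.2 hD.2.1 hE.1.2.2 h1⟩

/-- Only `n + 1` circles through `p` are tangent to `C`. A secant through `p` and `q` would force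
too many of them; without secants, `n + 1` circles meeting `C` at most once must cover its `n + 1`
points. -/
theorem isNucleus_of_two_tangents (h : IsInversivePlane n 𝒞) (hn : 2 ≤ n) (he : Even n)
    {C D D' : Set X} (hC : C ∈ 𝒞) (hD : D ∈ 𝒞) (hD' : D' ∈ 𝒞) (hne : D ≠ D') {p q : X}
    (hpq : p ≠ q) (hp : p ∉ C) (hq : q ∉ C) (hpD : p ∈ D) (hqD : q ∈ D) (hpD' : p ∈ D')
    (hqD' : q ∈ D') (h1 : (C ∩ D).ncard = 1) (h1' : (C ∩ D').ncard = 1) : IsNucleus 𝒞 C p q := by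
  -- no circle through `p` and `q` is a secant of `C`
  have key : ∀ E ∈ 𝒞, p ∈ E → q ∈ E → (C ∩ E).ncard ≤ 1 := by
    intro E hE hpE hqE
    by_contra! hlt
    -- The `n - 1` further points of the secant `E` give distinct tangents through `p`, none of
    -- which contains `q`, since a circle sharing three points with `E` is `E`.
    have hT : ∀ v ∈ E \ {p, q}, ∃ T, T ∈ 𝒞 ∧ p ∈ T ∧ v ∈ T ∧ (C ∩ T).ncard = 1 := by
      rintro v ⟨hvE, hv⟩
      simp only [Set.mem_insert_iff, Set.mem_singleton_iff, not_or] at hv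
      exact h.exists_tangent_through hn he hC (Ne.symm hv.1) hp
    choose! f hf using hT
    have hfE : ∀ v ∈ E \ {p, q}, ∀ w ∈ E, w ≠ p → w ∈ f v → w = v := by
      rintro v hv w hw hwp hwv
      by_contra hwne
      have h2 := hf v hv
      have hvp : v ≠ p := fun e => hv.2 (by simp [e])
      have : f v = E := h.eq_of_mem h2.1 hE hvp.symm hwp.symm (Ne.symm hwne) h2.2.1 h2.2.2.1 hwv
        hpE hv.1 hw
      rw [this] at h2
      omega
    have hinj : Set.InjOn f (E \ {p, q}) := by
      intro v hv w hw hvw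
      have hvp : v ≠ p := fun e => hv.2 (by simp [e])
      exact hfE w hw v hv.1 hvp (hvw ▸ (hf v hv).2.2.1)
    have hdisj : Disjoint {D | D ∈ 𝒞 ∧ p ∈ D ∧ q ∈ D ∧ (C ∩ D).ncard = 1}
        (f '' (E \ {p, q})) := by
      rw [Set.disjoint_left]
      rintro T hT ⟨v, hv, rfl⟩
      exact hv.2 (by simp [← hfE v hv q hqE hpq.symm hT.2.2.1])
    have hsub : {D | D ∈ 𝒞 ∧ p ∈ D ∧ q ∈ D ∧ (C ∩ D).ncard = 1} ∪ f '' (E \ {p, q}) ⊆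
        {D | D ∈ 𝒞 ∧ p ∈ D ∧ (C ∩ D).ncard = 1} := by
      rintro T (hT | ⟨v, hv, rfl⟩)
      · exact ⟨hT.1, hT.2.1, hT.2.2.2⟩
      · exact ⟨(hf v hv).1, (hf v hv).2.1, (hf v hv).2.2.2⟩
    have hle := Set.ncard_le_ncard hsub
    rw [Set.ncard_union_eq hdisj, hinj.ncard_image, h.ncard_diff_pair hE hpq hpE hqE,
      h.ncard_tangents_through_point hn hC hp] at hle
    -- The tangents through both `p` and `q` are at least two and odd in number, hence at least
    -- three: in total at least `n + 2`.
    have hodd := h.odd_ncard_tangents he hC hpq hp hq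
    have h2 : 1 < {D | D ∈ 𝒞 ∧ p ∈ D ∧ q ∈ D ∧ (C ∩ D).ncard = 1}.ncard :=
      (Set.one_lt_ncard_iff).2
        ⟨D, D', ⟨hD, hpD, hqD, h1⟩, ⟨hD', hpD', hqD', h1'⟩, hne⟩
    obtain ⟨k, hk⟩ := hodd
    omega
  refine ⟨hpq, hp, hq, fun E hE hpE hqE => ?_⟩
  by_contra hE1
  have hsum := ncard_eq_sum_ncard_of_existsUnique (h.existsUnique_circle_of_mem hpq hp hq)
  have hlt : ∑ i ∈ (Set.toFinite {D | D ∈ 𝒞 ∧ p ∈ D ∧ q ∈ D}).toFinset, {a ∈ C | a ∈ i}.ncard <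
      ∑ i ∈ (Set.toFinite {D | D ∈ 𝒞 ∧ p ∈ D ∧ q ∈ D}).toFinset, 1 := by
    refine Finset.sum_lt_sum (fun i hi => ?_) ⟨E, by simp [hE, hpE, hqE], ?_⟩
    · simp only [Set.Finite.mem_toFinset, Set.mem_ofPred_eq] at hi
      exact key i hi.1 hi.2.1 hi.2.2
    · exact lt_of_le_of_ne (key E hE hpE hqE) hE1
  rw [Finset.sum_const, smul_eq_mul, mul_one, ← Set.ncard_eq_toFinset_card,
    h.ncard_circles_through_pair hn hpq, ← hsum, h.card_circle C hC] at hlt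
  exact lt_irrefl _ hlt

/-- Otherwise each point other than `p` would lie on exactly one tangent through `p`, so `n + 1`
tangents with `n` further points each would partition only `n ^ 2` points. -/
theorem exists_isNucleus (h : IsInversivePlane n 𝒞) (hn : 2 ≤ n) (he : Even n) {C : Set X}
    (hC : C ∈ 𝒞) {p : X} (hp : p ∉ C) : ∃ q, IsNucleus 𝒞 C p q := by
  by_contra! hno
  have := ncard_eq_mul_of_existsUnique (S := ({p}ᶜ : Set X))
    (T := {D | D ∈ 𝒞 ∧ p ∈ D ∧ (C ∩ D).ncard = 1}) (r := fun D a => a ∈ D) (k := n) ?_ ?_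
  · rw [h.ncard_tangents_through_point hn hC hp, Set.ncard_compl, h.card_points,
      Set.ncard_singleton, Nat.add_sub_cancel, sq, add_mul] at this
    omega
  · intro q hq
    have hpq : p ≠ q := fun e => hq e.symm
    obtain ⟨D, hD, hpD, hqD, h1⟩ := h.exists_tangent_through hn he hC hpq hp
    refine ⟨D, ⟨⟨hD, hpD, h1⟩, hqD⟩, ?_⟩
    rintro E ⟨⟨hE, hpE, h1'⟩, hqE⟩
    by_contra hne
    by_cases hqC : q ∈ C
    · exact hne (h.eq_of_tangent hn hC hE hD hp hpE hpD hqC hqE hqD h1' h1)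
    · exact hno q (h.isNucleus_of_two_tangents hn he hC hE hD hne hpq hp hqC hpE hqE hpD hqD
        h1' h1)
  · rintro D ⟨hD, hpD, -⟩
    rw [← h.ncard_diff_singleton hD hpD]
    congr 1
    ext a
    simp only [Set.mem_ofPred_eq, Set.mem_sdiff, Set.mem_compl_iff]
    tauto

/-- A circle `E` through `p` and `q`, tangent to `C` at `u`, is also the circle through `p`, `q'`
and `u`, as tangents at `u` through `p` are unique. So every circle through `p` and `q` contains
`q'`, but there are several. -/
theorem IsNucleus.unique (h : IsInversivePlane n 𝒞) (hn : 2 ≤ n) {C : Set X}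
    (hC : C ∈ 𝒞) {p q q' : X} (hq : IsNucleus 𝒞 C p q) (hq' : IsNucleus 𝒞 C p q') : q = q' := by
  by_contra hne
  obtain ⟨D, hD, -⟩ := h.existsUnique_circle p q q' hq.ne hq'.ne hne
  obtain ⟨E, hE, hpE, hqE, hED⟩ := h.exists_ne_circle hn hq.ne D
  have h1 := hq.tangent E hE hpE hqE
  obtain ⟨u, hu⟩ := Set.ncard_eq_one.1 h1
  have huCE : u ∈ C ∩ E := by rw [hu]; rfl
  have hup : p ≠ u := fun e => hq.left (e ▸ huCE.1)
  have huq' : q' ≠ u := fun e => hq'.right (e ▸ huCE.1)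
  obtain ⟨G, hG, -⟩ := h.existsUnique_circle p q' u hq'.ne hup huq'
  have h2 := hq'.tangent G hG.1 hG.2.1 hG.2.2.1
  have hEG := h.eq_of_tangent hn hC hE hG.1 hq.left hpE hG.2.1 huCE.1 huCE.2 hG.2.2.2 h1 h2
  exact hED (h.eq_of_mem hE hD.1 hq.ne hq'.ne hne hpE hqE (hEG ▸ hG.2.2.1) hD.2.1 hD.2.2.1
    hD.2.2.2)

/-- The circles tangent to `D` at `r` partition the odd set `E \ {p, q}` for a second circle `E`
through `p` and `q`. One of them meets `E` in an odd number of points, hence touches both `D` and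
`E`. -/
theorem exists_isNucleus_through (h : IsInversivePlane n 𝒞) (hn : 2 ≤ n) (he : Even n) {p q r : X}
    (hpq : p ≠ q) (hpr : p ≠ r) (hqr : q ≠ r) {D : Set X} (hD : D ∈ 𝒞) (hpD : p ∈ D) (hqD : q ∈ D)
    (hrD : r ∈ D) : ∃ C ∈ 𝒞, C ∩ D = {r} ∧ IsNucleus 𝒞 C p q := by
  obtain ⟨E, hE, hpE, hqE, hED⟩ := h.exists_ne_circle hn hpq D
  have hED2 : ∀ s ∈ E \ {p, q}, s ∉ D := by
    rintro s ⟨hsE, hs⟩ hsD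
    simp only [Set.mem_insert_iff, Set.mem_singleton_iff, not_or] at hs
    exact hED (h.eq_of_mem hE hD hpq (Ne.symm hs.1) (Ne.symm hs.2) hpE hqE hsE hpD hqD hsD)
  obtain ⟨C, ⟨hC, hrC, hCD⟩, hodd⟩ := exists_odd_of_existsUnique (S := E \ {p, q})
    (T := {C | C ∈ 𝒞 ∧ r ∈ C ∧ D ∩ C = {r}}) (r := fun C a => a ∈ C) (fun s hs => by
      obtain ⟨C, hC, hu⟩ := h.existsUnique_tangent hn hD hrD (hED2 s hs)
      exact ⟨C, ⟨⟨hC.1, hC.2.1, hC.2.2.2⟩, hC.2.2.1⟩,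
        fun C' hC' => hu C' ⟨hC'.1.1, hC'.1.2.1, hC'.2, hC'.1.2.2⟩⟩) (by
      rw [h.ncard_diff_pair hE hpq hpE hqE]
      exact Nat.Even.sub_odd (by omega) he odd_one)
  have hpC : p ∉ C := fun hpC => hpr (by
    have : p ∈ D ∩ C := ⟨hpD, hpC⟩
    rw [hCD] at this; exact this)
  have hqC : q ∉ C := fun hqC => hqr (by
    have : q ∈ D ∩ C := ⟨hqD, hqC⟩
    rw [hCD] at this; exact this)
  have hset : {a ∈ E \ {p, q} | a ∈ C} = C ∩ E := by
    ext a
    simp only [Set.mem_ofPred_eq, Set.mem_sdiff, Set.mem_insert_iff, Set.mem_singleton_iff,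
      Set.mem_inter_iff]
    constructor
    · rintro ⟨⟨h1, -⟩, h2⟩; exact ⟨h2, h1⟩
    · rintro ⟨h1, h2⟩
      refine ⟨⟨h2, ?_⟩, h1⟩
      rintro (rfl | rfl)
      · exact hpC h1
      · exact hqC h1
  rw [hset] at hodd
  have h1 := h.ncard_inter_eq_one hC hE (fun e => hpC (e ▸ hpE)) hodd
  rw [Set.inter_comm] at hCD
  exact ⟨C, hC, hCD, h.isNucleus_of_two_tangents hn he hC hD hE hED.symm hpq hpC hqC hpD hqD hpE
    hqE (by rw [hCD]; exact Set.ncard_singleton r) h1⟩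

theorem ncard_tangent_pencil (h : IsInversivePlane n 𝒞) (hn : 2 ≤ n) {D : Set X} (hD : D ∈ 𝒞)
    {r : X} (hr : r ∈ D) : {C | C ∈ 𝒞 ∧ C ∩ D = {r}}.ncard = n - 1 := by
  have := ncard_eq_mul_of_existsUnique (S := Dᶜ)
    (T := {C | C ∈ 𝒞 ∧ C ∩ D = {r}}) (r := fun C a => a ∈ C) (k := n) ?_ ?_
  · rw [Set.ncard_compl, h.card_points, h.card_circle D hD,
      show n ^ 2 + 1 - (n + 1) = (n - 1) * n by rw [sq, Nat.sub_mul]; omega] at this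
    exact (Nat.eq_of_mul_eq_mul_right (by omega) this).symm
  · intro s hs
    obtain ⟨C, hC, hu⟩ := h.existsUnique_tangent hn hD hr hs
    have aux : ∀ {C' : Set X}, C' ∩ D = {r} → r ∈ C' := fun e =>
      (e.symm ▸ Set.mem_singleton r : r ∈ _ ∩ D).1
    exact ⟨C, ⟨⟨hC.1, by rw [Set.inter_comm]; exact hC.2.2.2⟩, hC.2.2.1⟩,
      fun C' hC' => hu C' ⟨hC'.1.1, aux hC'.1.2, hC'.2, by
        rw [Set.inter_comm]; exact hC'.1.2⟩⟩
  · rintro C ⟨hC, hCD⟩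
    have hrC : r ∈ C := (hCD.symm ▸ Set.mem_singleton r : r ∈ C ∩ D).1
    rw [← h.ncard_diff_singleton hC hrC]
    congr 1
    ext a
    simp only [Set.mem_ofPred_eq, Set.mem_sdiff, Set.mem_compl_iff, Set.mem_singleton_iff]
    constructor
    · rintro ⟨h1, h2⟩
      exact ⟨h2, fun e => h1 (e ▸ hr)⟩
    · rintro ⟨h1, h2⟩
      refine ⟨fun h3 => h2 ?_, h1⟩
      have : a ∈ C ∩ D := ⟨h1, h3⟩
      rwa [hCD] at this

/-- On the circle `D` through `p`, `q`, `r`, each of the `n - 1` points `s` other than `p`, `r`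
yields a circle tangent to `D` at `r` with nucleus pair `p`, `s`. Nuclei are unique, so this
exhausts the `n - 1` tangent circles at `r`, each occurring for one `s` only. -/
theorem IsNucleus.eq_of_mem (h : IsInversivePlane n 𝒞) (hn : 2 ≤ n) (he : Even n)
    {C C' : Set X} (hC : C ∈ 𝒞) (hC' : C' ∈ 𝒞) {p q r : X} (hq : IsNucleus 𝒞 C p q)
    (hq' : IsNucleus 𝒞 C' p q) (hr : r ∈ C) (hr' : r ∈ C') : C = C' := by
  have hpr : p ≠ r := fun e => hq.left (e ▸ hr)
  have hqr : q ≠ r := fun e => hq.right (e ▸ hr)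
  obtain ⟨D, ⟨hD, hpD, hqD, hrD⟩, -⟩ := h.existsUnique_circle p q r hq.ne hpr hqr
  have key : ∀ s ∈ D \ {p, r}, ∃ C, C ∈ 𝒞 ∧ C ∩ D = {r} ∧ IsNucleus 𝒞 C p s := by
    rintro s ⟨hsD, hs⟩
    simp only [Set.mem_insert_iff, Set.mem_singleton_iff, not_or] at hs
    obtain ⟨C, hC⟩ := h.exists_isNucleus_through hn he (Ne.symm hs.1) hpr hs.2 hD hpD hsD hrD
    exact ⟨C, hC⟩
  choose! f hf using key
  have hinj : Set.InjOn f (D \ {p, r}) := by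
    intro s hs t ht hst
    exact IsNucleus.unique h hn (hf s hs).1 (hf s hs).2.2 (hst ▸ (hf t ht).2.2)
  have hall : ∀ {C : Set X}, C ∈ 𝒞 → r ∈ C → IsNucleus 𝒞 C p q → C = f q := by
    intro C hC hr hq
    obtain ⟨s, hs, rfl⟩ := surjOn_of_injOn_of_ncard_le (T := {C | C ∈ 𝒞 ∧ C ∩ D = {r}})
      (fun s hs => ⟨(hf s hs).1, (hf s hs).2.1⟩) hinj
      (by rw [h.ncard_tangent_pencil hn hD hrD, h.ncard_diff_pair hD hpr hpD hrD])
      (i := C) ⟨hC, hq.inter_eq hD hpD hqD hr hrD⟩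
    rw [IsNucleus.unique h hn hC hq (hf s hs).2.2]
  rw [hall hC hr hq, hall hC' hr' hq']

theorem exists_isNucleus_mem (h : IsInversivePlane n 𝒞) (hn : 2 ≤ n) (he : Even n) {p q r : X}
    (hpq : p ≠ q) (hpr : p ≠ r) (hqr : q ≠ r) : ∃ C ∈ 𝒞, r ∈ C ∧ IsNucleus 𝒞 C p q := by
  obtain ⟨D, ⟨hD, hpD, hqD, hrD⟩, -⟩ := h.existsUnique_circle p q r hpq hpr hqr
  obtain ⟨C, hC, hCD, hN⟩ := h.exists_isNucleus_through hn he hpq hpr hqr hD hpD hqD hrD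
  exact ⟨C, hC, (hCD.symm ▸ Set.mem_singleton r : r ∈ C ∩ D).1, hN⟩

/-! ### Members of a flock have the carriers as nucleus pair. -/

section Flock

variable {F : Set (Set X)} {p q : X}

theorem ncard_flock (h : IsInversivePlane n 𝒞) (hn : 2 ≤ n) (hpq : p ≠ q) (hF : F ⊆ 𝒞)
    (hcover : ∀ a ∈ ({p, q}ᶜ : Set X), ∃! C, C ∈ F ∧ a ∈ C)
    (hsub : ∀ C ∈ F, C ⊆ {p, q}ᶜ) : F.ncard = n - 1 := by
  have := ncard_eq_mul_of_existsUnique (S := ({p, q}ᶜ : Set X)) (T := F)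
    (r := fun C a => a ∈ C) (k := n + 1) hcover (fun C hC => by
      rw [← h.card_circle C (hF hC)]
      congr 1
      ext a
      exact ⟨fun h => h.2, fun h => ⟨hsub C hC h, h⟩⟩)
  rw [h.ncard_compl_pair hpq, show n ^ 2 - 1 = (n - 1) * (n + 1) by
      obtain ⟨m, rfl⟩ : ∃ m, n = m + 1 := ⟨n - 1, by omega⟩
      simp only [Nat.add_sub_cancel]
      rw [show (m + 1) ^ 2 = m * (m + 1 + 1) + 1 by ring, Nat.add_sub_cancel]] at this
  exact (Nat.eq_of_mul_eq_mul_right (by omega) this).symm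

/-- Each of the `n` circles other than `D` through `r` and `s` misses the carriers, so some flock
member meets it in an odd number of points. The flock has only `n - 1` members, so one member serves
two of these circles and is tangent to both. -/
theorem exists_mem_flock_isNucleus (h : IsInversivePlane n 𝒞) (hn : 2 ≤ n) (he : Even n)
    (hpq : p ≠ q) (hF : F ⊆ 𝒞) (hcover : ∀ a ∈ ({p, q}ᶜ : Set X), ∃! C, C ∈ F ∧ a ∈ C)
    (hsub : ∀ C ∈ F, C ⊆ {p, q}ᶜ) {D : Set X} (hD : D ∈ 𝒞) (hpD : p ∈ D) (hqD : q ∈ D) {r s : X}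
    (hr : r ∈ D \ {p, q}) (hs : s ∈ D \ {p, q}) (hrs : r ≠ s) : ∃ C ∈ F, IsNucleus 𝒞 C r s := by
  obtain ⟨hrD, hr⟩ := hr
  obtain ⟨hsD, hs⟩ := hs
  simp only [Set.mem_insert_iff, Set.mem_singleton_iff, not_or] at hr hs
  have key : ∀ E ∈ {E | E ∈ 𝒞 ∧ r ∈ E ∧ s ∈ E} \ {D}, ∃ C, C ∈ F ∧ Odd (C ∩ E).ncard := by
    rintro E ⟨⟨hE, hrE, hsE⟩, hED⟩
    have hpE : p ∉ E := fun hpE => hED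
      (h.eq_of_mem hE hD hrs hr.1 hs.1 hrE hsE hpE hrD hsD hpD)
    have hqE : q ∉ E := fun hqE => hED
      (h.eq_of_mem hE hD hrs hr.2 hs.2 hrE hsE hqE hrD hsD hqD)
    obtain ⟨C, hC, hodd⟩ := exists_odd_of_existsUnique (S := E) (T := F)
      (r := fun C a => a ∈ C) (fun a ha => hcover a (by
        rintro (rfl | rfl)
        · exact hpE ha
        · exact hqE ha)) (by rw [h.card_circle E hE]; exact he.add_one)
    refine ⟨C, hC, ?_⟩
    rw [Set.inter_comm]
    exact hodd
  choose! f hf using key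
  have hcard : ({E | E ∈ 𝒞 ∧ r ∈ E ∧ s ∈ E} \ {D}).ncard = n := by
    rw [Set.ncard_sdiff_singleton_of_mem (Set.mem_ofPred_eq ▸ ⟨hD, hrD, hsD⟩), h.ncard_circles_through_pair hn hrs]
    omega
  obtain ⟨E, hE, E', hE', hne, hff⟩ := Set.exists_ne_map_eq_of_ncard_lt_of_maps_to
    (s := {E | E ∈ 𝒞 ∧ r ∈ E ∧ s ∈ E} \ {D}) (t := F)
    (by rw [hcard, h.ncard_flock hn hpq hF hcover hsub]; omega) (f := f)
    (fun E hE => (hf E hE).1)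
  obtain ⟨hC, hodd⟩ := hf E hE
  have hodd' := (hf E' hE').2
  rw [← hff] at hodd'
  set C := f E with hCdef
  clear_value C
  -- An odd intersection also arises if `C` is itself one of the two circles; but then it would meet
  -- the other one in both `r` and `s`.
  have hCE : ∀ {E E'}, E ≠ E' → E ∈ {E | E ∈ 𝒞 ∧ r ∈ E ∧ s ∈ E} → E' ∈ {E | E ∈ 𝒞 ∧ r ∈ E ∧ s ∈ E} →
      Odd (C ∩ E').ncard → C ≠ E := by
    rintro E E' hne ⟨hE, hrE, hsE⟩ ⟨hE', hrE', hsE'⟩ hodd rfl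
    have : 1 < (C ∩ E').ncard :=
      (Set.one_lt_ncard_iff).2 ⟨r, s, ⟨hrE, hrE'⟩, ⟨hsE, hsE'⟩, hrs⟩
    rw [h.ncard_inter_eq_one hE hE' hne hodd] at this
    exact lt_irrefl _ this
  have h1 := h.ncard_inter_eq_one (hF hC) hE.1.1 (hCE hne hE.1 hE'.1 hodd') hodd
  have h1' := h.ncard_inter_eq_one (hF hC) hE'.1.1 (hCE hne.symm hE'.1 hE.1 hodd) hodd'
  have hnot : ¬ (r ∈ C ∧ s ∈ C) := by
    rintro ⟨hrC, hsC⟩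
    have : 1 < (C ∩ E).ncard :=
      (Set.one_lt_ncard_iff).2 ⟨r, s, ⟨hrC, hE.1.2.1⟩, ⟨hsC, hE.1.2.2⟩, hrs⟩
    omega
  have hrC : r ∉ C := fun hrC => hne (h.eq_of_tangent hn (hF hC) hE.1.1 hE'.1.1
    (fun hsC => hnot ⟨hrC, hsC⟩) hE.1.2.2 hE'.1.2.2 hrC hE.1.2.1 hE'.1.2.1 h1 h1')
  have hsC : s ∉ C := fun hsC => hne (h.eq_of_tangent hn (hF hC) hE.1.1 hE'.1.1
    hrC hE.1.2.1 hE'.1.2.1 hsC hE.1.2.2 hE'.1.2.2 h1 h1')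
  exact ⟨C, hC, h.isNucleus_of_two_tangents hn he (hF hC) hE.1.1 hE'.1.1 hne hrs hrC hsC
    hE.1.2.1 hE.1.2.2 hE'.1.2.1 hE'.1.2.2 h1 h1'⟩

/-- Fix `r` on `D` off `C`. The flock members with nucleus pair `r`, `s`, as `s` runs over the other
`n - 2` points of `D \ {p, q}`, are distinct and avoid `r`, so they are all members avoiding `r`.
Thus `C` is one of them, and `D`, passing through `r` and `s`, is tangent to it. -/
theorem isNucleus_of_mem_flock (h : IsInversivePlane n 𝒞) (hn : 4 ≤ n) (he : Even n)
    (hpq : p ≠ q) (hF : F ⊆ 𝒞) (hcover : ∀ a ∈ ({p, q}ᶜ : Set X), ∃! C, C ∈ F ∧ a ∈ C)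
    (hsub : ∀ C ∈ F, C ⊆ {p, q}ᶜ) {C : Set X} (hC : C ∈ F) : IsNucleus 𝒞 C p q := by
  have hpC : p ∉ C := fun hp => hsub C hC hp (by simp)
  refine ⟨hpq, hpC, fun hq => hsub C hC hq (by simp), fun D hD hpD hqD => ?_⟩
  -- Here `4 ≤ n` is needed: `D \ {p, q}` has at least three points, while `C` contains at most two
  -- points of `D`.
  obtain ⟨r, hr, hrC⟩ : ∃ r ∈ D \ {p, q}, r ∉ C := by
    by_contra! hall
    have h1 := Set.ncard_le_ncard (s := D \ {p, q}) (t := C ∩ D) fun a ha => ⟨hall a ha, ha.1⟩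
    have h2 := h.ncard_inter_le (hF hC) hD (fun e => hpC (e ▸ hpD))
    rw [h.ncard_diff_pair hD hpq hpD hqD] at h1
    omega
  obtain ⟨C₀, ⟨hC₀, hrC₀⟩, -⟩ := hcover r hr.2
  have key : ∀ s ∈ (D \ {p, q}) \ {r}, ∃ C, C ∈ F ∧ IsNucleus 𝒞 C r s := by
    rintro s ⟨hs, hsr⟩
    exact h.exists_mem_flock_isNucleus (by omega) he hpq hF hcover hsub hD hpD hqD hr hs
      (fun e => hsr e.symm)
  choose! f hf using key
  obtain ⟨s, hs, rfl⟩ := surjOn_of_injOn_of_ncard_le (S := (D \ {p, q}) \ {r}) (T := F \ {C₀})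
    (f := f) (fun s hs => ⟨(hf s hs).1, fun e => (hf s hs).2.left (by
      rw [Set.mem_singleton_iff.1 e]; exact hrC₀)⟩)
    (fun s hs t ht hst => IsNucleus.unique h (by omega) (hF (hf s hs).1) (hf s hs).2
      (hst ▸ (hf t ht).2))
    (by
      rw [Set.ncard_sdiff_singleton_of_mem hC₀, Set.ncard_sdiff_singleton_of_mem hr,
        h.ncard_diff_pair hD hpq hpD hqD, h.ncard_flock (by omega) hpq hF hcover hsub])
    (i := C) ⟨hC, fun e => hrC (by rw [Set.mem_singleton_iff.1 e]; exact hrC₀)⟩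
  exact (hf s hs).2.tangent D hD hr.1 hs.1.1

end Flock

end IsInversivePlane

/-! ### Consequences of conditions (I) and (II) for parallelism. -/

namespace Unital

variable {P : Type*} {n : ℕ} (U : Unital P n)

theorem eq_of_mem {K K' : Set P} (hK : K ∈ U.lines) (hK' : K' ∈ U.lines) {p q : P} (hpq : p ≠ q)
    (hp : p ∈ K) (hq : q ∈ K) (hp' : p ∈ K') (hq' : q ∈ K') : K = K' :=
  (U.existsUnique_line p q hpq).unique ⟨hK, hp, hq⟩ ⟨hK', hp', hq'⟩

theorem point_eq_of_mem {K K' : Set P} (hK : K ∈ U.lines) (hK' : K' ∈ U.lines) (hne : K ≠ K')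
    {p q : P} (hp : p ∈ K) (hq : q ∈ K) (hp' : p ∈ K') (hq' : q ∈ K') : p = q := by
  by_contra hpq
  exact hne (U.eq_of_mem hK hK' hpq hp hq hp' hq')

theorem exists_line {p q : P} (hpq : p ≠ q) : ∃ K ∈ U.lines, p ∈ K ∧ q ∈ K :=
  (U.existsUnique_line p q hpq).exists

/-- The lines through `x` that meet `M`. -/
def star (x : P) (M : Set P) : Set (Set P) :=
  {K | K ∈ U.lines ∧ x ∈ K ∧ (K ∩ M).Nonempty}

/-- No line missing `x` meets all of the lines `A`, `B`, `C` through `x`. -/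
def NonCocircular (x : P) (A B C : Set P) : Prop :=
  ¬ ∃ M ∈ U.lines, x ∉ M ∧ (M ∩ A).Nonempty ∧ (M ∩ B).Nonempty ∧ (M ∩ C).Nonempty

variable {U}

theorem parallel_of_star_eq {x : P} {M M' : Set P} (hM : M ∈ U.lines) (hx : x ∉ M)
    (hM' : M' ∈ U.lines) (hx' : x ∉ M') (h : U.star x M = U.star x M') : U.Parallel x M M' := by
  refine ⟨⟨hM, hx⟩, ⟨hM', hx'⟩, fun K hK hxK => ⟨fun hm => ?_, fun hm => ?_⟩⟩
  · have : K ∈ U.star x M := ⟨hK, hxK, hm⟩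
    rw [h] at this
    exact this.2.2
  · have : K ∈ U.star x M' := ⟨hK, hxK, hm⟩
    rw [← h] at this
    exact this.2.2

theorem Parallel.symm {x : P} {M M' : Set P} (h : U.Parallel x M M') : U.Parallel x M' M :=
  ⟨h.2.1, h.1, fun K hK hx => (h.2.2 K hK hx).symm⟩

theorem Parallel.trans {x : P} {M M' M'' : Set P} (h : U.Parallel x M M')
    (h' : U.Parallel x M' M'') : U.Parallel x M M'' :=
  ⟨h.1, h'.2.1, fun K hK hx => (h.2.2 K hK hx).trans (h'.2.2 K hK hx)⟩

theorem NonCocircular.swap_left {x : P} {A B C : Set P} (h : U.NonCocircular x A B C) :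
    U.NonCocircular x B A C := fun ⟨M, hM, hx, h1, h2, h3⟩ => h ⟨M, hM, hx, h2, h1, h3⟩

theorem NonCocircular.swap_right {x : P} {A B C : Set P} (h : U.NonCocircular x A B C) :
    U.NonCocircular x A C B := fun ⟨M, hM, hx, h1, h2, h3⟩ => h ⟨M, hM, hx, h1, h3, h2⟩

/-- The form in which (I) is applied: two lines through `x` and two through `y` with all cross pairs
meeting. -/
theorem ConditionI.false_of_meet (hI : U.ConditionI) {x y : P} {K₁ K₂ M₁ M₂ : Set P}
    (hK₁ : K₁ ∈ U.lines) (hK₂ : K₂ ∈ U.lines) (hM₁ : M₁ ∈ U.lines) (hM₂ : M₂ ∈ U.lines)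
    (hK : K₁ ≠ K₂) (hM : M₁ ≠ M₂) (hx₁ : x ∈ K₁) (hx₂ : x ∈ K₂) (hy₁ : y ∈ M₁) (hy₂ : y ∈ M₂)
    (hyK₁ : y ∉ K₁) (hyK₂ : y ∉ K₂) (hxM₁ : x ∉ M₁) (hxM₂ : x ∉ M₂) (h11 : (K₁ ∩ M₁).Nonempty)
    (h12 : (K₁ ∩ M₂).Nonempty) (h21 : (K₂ ∩ M₁).Nonempty) (h22 : (K₂ ∩ M₂).Nonempty) : False := by
  have e11 : K₁ ≠ M₁ := fun e => hxM₁ (e ▸ hx₁)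
  have e12 : K₁ ≠ M₂ := fun e => hxM₂ (e ▸ hx₁)
  have e21 : K₂ ≠ M₁ := fun e => hxM₁ (e ▸ hx₂)
  have e22 : K₂ ≠ M₂ := fun e => hxM₂ (e ▸ hx₂)
  have hKK : (K₁ ∩ K₂).Nonempty := ⟨x, hx₁, hx₂⟩
  have hMM : (M₁ ∩ M₂).Nonempty := ⟨y, hy₁, hy₂⟩
  have c1 : ∀ p, p ∈ K₁ → p ∈ K₂ → p = x := fun p h1 h2 =>
    U.point_eq_of_mem hK₁ hK₂ hK h1 hx₁ h2 hx₂
  have c2 : ∀ p, p ∈ M₁ → p ∈ M₂ → p = y := fun p h1 h2 =>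
    U.point_eq_of_mem hM₁ hM₂ hM h1 hy₁ h2 hy₂
  have d1 : ∀ p, p ∈ K₁ → p ∈ K₂ → p ∉ M₁ := fun p h1 h2 h3 => hxM₁ (c1 p h1 h2 ▸ h3)
  have d2 : ∀ p, p ∈ K₁ → p ∈ K₂ → p ∉ M₂ := fun p h1 h2 h3 => hxM₂ (c1 p h1 h2 ▸ h3)
  have d3 : ∀ p, p ∈ M₁ → p ∈ M₂ → p ∉ K₁ := fun p h1 h2 h3 => hyK₁ (c2 p h1 h2 ▸ h3)
  have d4 : ∀ p, p ∈ M₁ → p ∈ M₂ → p ∉ K₂ := fun p h1 h2 h3 => hyK₂ (c2 p h1 h2 ▸ h3)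
  refine hI ⟨![K₁, K₂, M₁, M₂], ?_, ?_, ?_, ?_⟩
  · intro i j hij
    fin_cases i <;> fin_cases j <;> simp_all [eq_comm]
  · intro i
    fin_cases i <;> simpa
  · intro i j hij
    fin_cases i <;> fin_cases j <;> first | exact absurd rfl hij | assumption |
      (rw [Set.inter_comm]; assumption)
  · intro i j k hij hik hjk
    rw [Set.eq_empty_iff_forall_notMem]
    rintro p ⟨⟨h1, h2⟩, h3⟩
    have hp : ∀ i : Fin 4, p ∈ ![K₁, K₂, M₁, M₂] i ↔ (i = 0 ∧ p ∈ K₁) ∨ (i = 1 ∧ p ∈ K₂) ∨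
        (i = 2 ∧ p ∈ M₁) ∨ (i = 3 ∧ p ∈ M₂) := by
      intro i
      fin_cases i <;> simp
    rw [hp] at h1 h2 h3
    have := d1 p; have := d2 p; have := d3 p; have := d4 p
    grind

/-- A line meeting two disjoint `z`- and `w`-parallel lines contains at most one such point. -/
theorem Parallel.center_unique (hI : U.ConditionI) {x y z w : P}
    {L M D : Set P} (hz : U.Parallel z L M) (hw : U.Parallel w L M) (hLM : Disjoint L M)
    (hD : D ∈ U.lines) (hxL : x ∈ L) (hyM : y ∈ M) (hxD : x ∈ D) (hyD : y ∈ D) (hzD : z ∈ D)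
    (hwD : w ∈ D) (hn : 4 ≤ n) : z = w := by
  by_contra hzw
  obtain ⟨⟨hL, hzL⟩, ⟨hM, hzM⟩, -⟩ := id hz
  obtain ⟨⟨-, hwL⟩, ⟨-, hwM⟩, -⟩ := id hw
  obtain ⟨p, hpM, hpy⟩ : ∃ p ∈ M, p ≠ y :=
    Set.exists_ne_of_one_lt_ncard (by rw [U.card_line M hM]; omega) y
  have hzp : z ≠ p := fun e => hzM (e ▸ hpM)
  have hwp : w ≠ p := fun e => hwM (e ▸ hpM)
  have hMD : M ≠ D := fun e => hzM (e ▸ hzD)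
  have hLD : L ≠ D := fun e => hzL (e ▸ hzD)
  have hpD : p ∉ D := fun hpD => hpy (U.point_eq_of_mem hM hD hMD hpM hyM hpD hyD)
  have hpL : p ∉ L := fun hpL => Set.disjoint_left.1 hLM hpL hpM
  have hxz : x ≠ z := fun e => hzL (e ▸ hxL)
  have hxw : x ≠ w := fun e => hwL (e ▸ hxL)
  obtain ⟨J, hJ, hzJ, hpJ⟩ := U.exists_line hzp
  obtain ⟨G, hG, hwG, hpG⟩ := U.exists_line hwp
  have hJD : J ≠ D := fun e => hpD (e ▸ hpJ)
  have hGD : G ≠ D := fun e => hpD (e ▸ hpG)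
  refine hI.false_of_meet hL hD hJ hG hLD (fun e => hJD (U.eq_of_mem hJ hD hzw hzJ (e ▸ hwG) hzD hwD))
    hxL hxD hpJ hpG hpL hpD (fun h => hJD (U.eq_of_mem hJ hD hxz h hzJ hxD hzD))
    (fun h => hGD (U.eq_of_mem hG hD hxw h hwG hxD hwD)) ?_ ?_ ⟨z, hzD, hzJ⟩ ⟨w, hwD, hwG⟩
  · rw [Set.inter_comm]; exact (hz.2.2 J hJ hzJ).2 ⟨p, hpJ, hpM⟩
  · rw [Set.inter_comm]; exact (hw.2.2 G hG hwG).2 ⟨p, hpG, hpM⟩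

variable [Finite P]

theorem ncard_lines_through (hn : 1 ≤ n) (x : P) : {K | K ∈ U.lines ∧ x ∈ K}.ncard = n ^ 2 := by
  have := ncard_eq_mul_of_existsUnique (S := ({x}ᶜ : Set P)) (T := {K | K ∈ U.lines ∧ x ∈ K})
    (r := fun K a => a ∈ K) (k := n) ?_ ?_
  · rw [Set.ncard_compl, U.card_points, Set.ncard_singleton, Nat.add_sub_cancel, pow_succ] at this
    exact (Nat.eq_of_mul_eq_mul_right (by omega) this).symm
  · intro a ha
    obtain ⟨K, hK, hu⟩ := U.existsUnique_line x a (fun e => ha e.symm)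
    exact ⟨K, ⟨⟨hK.1, hK.2.1⟩, hK.2.2⟩, fun K' hK' => hu K' ⟨hK'.1.1, hK'.1.2, hK'.2⟩⟩
  · rintro K ⟨hK, hx⟩
    have : (K \ {x}).ncard = n := by
      rw [Set.ncard_sdiff_singleton_of_mem hx, U.card_line K hK, Nat.add_sub_cancel]
    rw [← this]
    congr 1
    ext a
    simp only [Set.mem_ofPred_eq, Set.mem_sdiff, Set.mem_compl_iff]
    tauto

theorem ncard_star {x : P} {M : Set P} (hM : M ∈ U.lines) (hx : x ∉ M) :
    (U.star x M).ncard = n + 1 := by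
  have := ncard_eq_mul_of_existsUnique (S := M) (T := U.star x M)
    (r := fun K a => a ∈ K) (k := 1) ?_ ?_
  · rw [U.card_line M hM, mul_one] at this
    exact this.symm
  · intro a ha
    obtain ⟨K, hK, hu⟩ := U.existsUnique_line x a (fun e => hx (e ▸ ha))
    exact ⟨K, ⟨⟨hK.1, hK.2.1, ⟨a, hK.2.2, ha⟩⟩, hK.2.2⟩,
      fun K' hK' => hu K' ⟨hK'.1.1, hK'.1.2.1, hK'.2⟩⟩
  · rintro K ⟨hK, hxK, p, hpK, hpM⟩
    rw [Set.ncard_eq_one]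
    refine ⟨p, Set.Subset.antisymm ?_ (by rintro _ rfl; exact ⟨hpM, hpK⟩)⟩
    rintro a ⟨haM, haK⟩
    exact U.point_eq_of_mem hM hK (fun e => hx (e ▸ hxK)) haM hpM haK hpK

theorem parallel_of_star_subset {x : P} {M M' : Set P} (hM : M ∈ U.lines) (hx : x ∉ M)
    (hM' : M' ∈ U.lines) (hx' : x ∉ M') (h : U.star x M ⊆ U.star x M') : U.Parallel x M M' :=
  parallel_of_star_eq hM hx hM' hx' (Set.eq_of_subset_of_ncard_le h
    (by rw [ncard_star hM hx, ncard_star hM' hx']))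

theorem exists_parallel (hII : U.ConditionII) {x y : P} {L M : Set P} (hL : L ∈ U.lines)
    (hM : M ∈ U.lines) (hxL : x ∈ L) (hxM : x ∉ M) (hLM : (L ∩ M).Nonempty) (hyL : y ∈ L)
    (hyx : y ≠ x) : ∃ M' ∈ U.lines, y ∈ M' ∧ U.Parallel x M M' := by
  obtain ⟨M', hM', hy, hx, h⟩ := hII x L hL M hM hxL hxM hLM y hyL hyx
  exact ⟨M', hM', hy, parallel_of_star_subset hM hxM hM' hx fun K hK =>
    ⟨hK.1, hK.2.1, h K hK.1 hK.2.1 hK.2.2⟩⟩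

theorem Parallel.eq_of_mem (hn : 4 ≤ n) (hI : U.ConditionI) {x p : P} {M M' : Set P}
    (h : U.Parallel x M M') (hp : p ∈ M) (hp' : p ∈ M') : M = M' := by
  by_contra hne
  obtain ⟨⟨hM, hx⟩, ⟨hM', hx'⟩, -⟩ := id h
  obtain ⟨K, hK, hxK, hpK⟩ := U.exists_line (p := x) (q := p) fun e => hx (e ▸ hp)
  have hcard : 1 < (U.star x M \ {K}).ncard := by
    rw [Set.ncard_sdiff_singleton_of_mem
      (show K ∈ U.star x M from ⟨hK, hxK, p, hpK, hp⟩), ncard_star hM hx]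
    omega
  obtain ⟨K₁, K₂, ⟨h1, h1K⟩, ⟨h2, h2K⟩, h12⟩ := (Set.one_lt_ncard_iff).1 hcard
  have hxp : x ≠ p := fun e => hx (e ▸ hp)
  exact hI.false_of_meet h1.1 h2.1 hM hM' h12 hne h1.2.1 h2.2.1 hp hp'
    (fun hpK₁ => h1K (U.eq_of_mem h1.1 hK hxp h1.2.1 hpK₁ hxK hpK))
    (fun hpK₂ => h2K (U.eq_of_mem h2.1 hK hxp h2.2.1 hpK₂ hxK hpK)) hx hx' h1.2.2
    ((h.2.2 _ h1.1 h1.2.1).1 h1.2.2) h2.2.2 ((h.2.2 _ h2.1 h2.2.1).1 h2.2.2)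

theorem Parallel.disjoint (hn : 4 ≤ n) (hI : U.ConditionI) {x : P} {M M' : Set P}
    (h : U.Parallel x M M') (hne : M ≠ M') : Disjoint M M' :=
  Set.disjoint_left.2 fun _ hp hp' => hne (h.eq_of_mem hn hI hp hp')

/-- Move `M'` by (II) to a parallel `N` through the point `A ∩ M`. If `N ≠ M`, then `B`, `C`, `M`,
`N` violate (I). -/
theorem parallel_of_three_meet (hI : U.ConditionI) (hII : U.ConditionII) {x : P}
    {A B C M M' : Set P} (hA : A ∈ U.lines) (hB : B ∈ U.lines) (hC : C ∈ U.lines) (hxA : x ∈ A)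
    (hxB : x ∈ B) (hxC : x ∈ C) (hAB : A ≠ B) (hAC : A ≠ C) (hBC : B ≠ C) (hM : M ∈ U.lines)
    (hM' : M' ∈ U.lines) (hx : x ∉ M) (hx' : x ∉ M') (hAM : (A ∩ M).Nonempty)
    (hBM : (B ∩ M).Nonempty) (hCM : (C ∩ M).Nonempty) (hAM' : (A ∩ M').Nonempty)
    (hBM' : (B ∩ M').Nonempty) (hCM' : (C ∩ M').Nonempty) : U.Parallel x M M' := by
  obtain ⟨y, hyA, hyM⟩ := id hAM
  have hyx : y ≠ x := fun e => hx (e ▸ hyM)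
  obtain ⟨N, hN, hyN, hpar⟩ := exists_parallel hII hA hM' hxA hx' hAM' hyA hyx
  by_cases hMN : M = N
  · subst hMN; exact hpar.symm
  · exact (hI.false_of_meet hB hC hM hN hBC hMN hxB hxC hyM hyN
      (fun hyB => hAB (U.eq_of_mem hA hB hyx hyA hxA hyB hxB))
      (fun hyC => hAC (U.eq_of_mem hA hC hyx hyA hxA hyC hxC)) hx hpar.2.1.2 hBM
      ((hpar.2.2 B hB hxB).1 hBM') hCM ((hpar.2.2 C hC hxC).1 hCM')).elim

/-- A line meeting `D`, `A`, `B` could be moved by (II) to a line `J` through `z`. Meeting `A`, it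
meets `M` in some `p`; then `wp` meets `B`, and `B`, `D`, `J`, `wp` form an O'Nan configuration. -/
theorem nonCocircular_of_parallel (hI : U.ConditionI) (hII : U.ConditionII) (hn : 4 ≤ n)
    {x y z w : P} {A B M D : Set P} (hD : D ∈ U.lines) (hxD : x ∈ D)
    (hyD : y ∈ D) (hzD : z ∈ D) (hwD : w ∈ D) (hxy : x ≠ y) (hzw : z ≠ w) (hyM : y ∈ M)
    (hxA : x ∈ A) (hxB : x ∈ B) (hz : U.Parallel z A M) (hw : U.Parallel w B M) :
    U.NonCocircular x D A B := by
  rintro ⟨J₀, hJ₀, hxJ₀, hJD, hJA, hJB⟩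
  obtain ⟨⟨hA, hzA⟩, ⟨hM, hzM⟩, -⟩ := id hz
  obtain ⟨⟨hB, hwB⟩, ⟨-, hwM⟩, -⟩ := id hw
  have hMD : M ≠ D := fun e => hzM (e ▸ hzD)
  have hBD : B ≠ D := fun e => hwB (e ▸ hwD)
  have hzx : z ≠ x := fun e => hzA (e ▸ hxA)
  have hzy : z ≠ y := fun e => hzM (e ▸ hyM)
  have hwx : w ≠ x := fun e => hwB (e ▸ hxB)
  have hxM : x ∉ M := fun h => hxy (U.point_eq_of_mem hM hD hMD h hyM hxD hyD)
  obtain ⟨J, hJ, hzJ, hpar⟩ := exists_parallel hII hD hJ₀ hxD hxJ₀ (by rwa [Set.inter_comm]) hzD hzx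
  have hxJ := hpar.2.1.2
  have hAJ := (hpar.2.2 A hA hxA).1 (by rwa [Set.inter_comm])
  have hBJ := (hpar.2.2 B hB hxB).1 (by rwa [Set.inter_comm])
  obtain ⟨p, hpJ, hpM⟩ := (hz.2.2 J hJ hzJ).1 (by rwa [Set.inter_comm])
  have hJD' : J ≠ D := fun e => hxJ (e ▸ hxD)
  have hpD : p ∉ D := fun hpD => hzM (U.point_eq_of_mem hJ hD hJD' hpJ hzJ hpD hzD ▸ hpM)
  have hMB : M ≠ B := fun e => hxM (e ▸ hxB)
  have hpB : p ∉ B := fun hpB => Set.disjoint_left.1 (hw.disjoint hn hI hMB.symm) hpB hpM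
  obtain ⟨G, hG, hwG, hpG⟩ := U.exists_line (p := w) (q := p) fun e => hwM (e ▸ hpM)
  have hGD : G ≠ D := fun e => hpD (e ▸ hpG)
  have hBG := (hw.2.2 G hG hwG).2 ⟨p, hpG, hpM⟩
  exact hI.false_of_meet hB hD hJ hG hBD
    (fun e => hJD' (U.eq_of_mem hJ hD hzw hzJ (e ▸ hwG) hzD hwD)) hxB hxD hpJ hpG hpB hpD hxJ
    (fun h => hGD (U.eq_of_mem hG hD hwx hwG h hwD hxD)) hBJ (by rwa [Set.inter_comm])
    ⟨z, hzD, hzJ⟩ ⟨w, hwD, hwG⟩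

end Unital

/-! ### The inversive plane at a point. -/

namespace Unital

variable {P : Type*} {n : ℕ} {U : Unital P n}

theorem mem_blockOf {x : P} {A B C : U.Pencil x} :
    C ∈ U.blockOf x A B ↔ C = A ∨ C = B ∨ U.NonCocircular x A.1 B.1 C.1 := by
  simp only [blockOf, NonCocircular, Set.mem_union, Set.mem_insert_iff, Set.mem_singleton_iff,
    or_assoc, Set.mem_ofPred_eq]

theorem some_mem_circleOf {x : P} {A : U.Pencil x} {M : Set P} :
    some A ∈ U.circleOf x M ↔ (A.1 ∩ M).Nonempty := by
  simp [circleOf]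

theorem none_notMem_circleOf {x : P} {M : Set P} : none ∉ U.circleOf x M := by
  simp [circleOf]

theorem blockOf_comm {x : P} (A B : U.Pencil x) : U.blockOf x A B = U.blockOf x B A := by
  ext C
  rw [mem_blockOf, mem_blockOf]
  constructor <;> rintro (h | h | h)
  · exact .inr (.inl h)
  · exact .inl h
  · exact .inr (.inr h.swap_left)
  · exact .inr (.inl h)
  · exact .inl h
  · exact .inr (.inr h.swap_left)

theorem ncard_image_val {x : P} (S : Set (U.Pencil x)) :
    (Subtype.val '' S).ncard = S.ncard :=
  Set.ncard_image_of_injective S Subtype.val_injective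

variable [Finite P]

/-- Count the complement. Fix `y ≠ x` on `D`. By (II) and (I), a line `B` cocircular with `D` and
`A` meets exactly one of the `n` lines other than `D` that join `y` to points of `A`. Each such line
accounts for `n - 1` choices of `B`, leaving `n ^ 2 - 2 - n * (n - 1) = n - 2`. -/
theorem ncard_nonCocircular (hn : 4 ≤ n) (hI : U.ConditionI) (hII : U.ConditionII) {x : P}
    {D A : Set P} (hD : D ∈ U.lines) (hA : A ∈ U.lines) (hxD : x ∈ D) (hxA : x ∈ A) (hDA : D ≠ A) :
    {B | (B ∈ U.lines ∧ x ∈ B) ∧ B ∉ ({D, A} : Set (Set P)) ∧ U.NonCocircular x D A B}.ncard =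
      n - 2 := by
  obtain ⟨y, hyD, hyx⟩ : ∃ y ∈ D, y ≠ x :=
    Set.exists_ne_of_one_lt_ncard (by rw [U.card_line D hD]; omega) x
  have hyA : y ∉ A := fun h => hDA (U.eq_of_mem hD hA hyx hyD hxD h hxA)
  have hDy : D ∈ U.star y A := ⟨hD, hyD, x, hxD, hxA⟩
  have hcard := ncard_eq_mul_of_existsUnique
    (S := {B | (B ∈ U.lines ∧ x ∈ B) ∧ B ∉ ({D, A} : Set (Set P)) ∧ ¬ U.NonCocircular x D A B})
    (T := U.star y A \ {D}) (r := fun M B => (B ∩ M).Nonempty) (k := n - 1) ?_ ?_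
  · rw [Set.ncard_sdiff_singleton_of_mem hDy, ncard_star hA hyA, Nat.add_sub_cancel] at hcard
    have hunion : {B | (B ∈ U.lines ∧ x ∈ B) ∧ B ∉ ({D, A} : Set (Set P)) ∧
        U.NonCocircular x D A B} = ({B | B ∈ U.lines ∧ x ∈ B} \ {D, A}) \ {B | (B ∈ U.lines ∧ x ∈ B) ∧
          B ∉ ({D, A} : Set (Set P)) ∧ ¬ U.NonCocircular x D A B} := by
      ext B
      exact ⟨fun ⟨a, b, c⟩ => ⟨⟨a, b⟩, fun h => h.2.2 c⟩,
        fun ⟨⟨a, b⟩, c⟩ => ⟨a, b, by_contra fun h => c ⟨a, b, h⟩⟩⟩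
    have hsub : {B | (B ∈ U.lines ∧ x ∈ B) ∧ B ∉ ({D, A} : Set (Set P)) ∧
        ¬ U.NonCocircular x D A B} ⊆ {B | B ∈ U.lines ∧ x ∈ B} \ {D, A} :=
      fun B hB => ⟨hB.1, hB.2.1⟩
    rw [hunion, Set.ncard_sdiff hsub, hcard,
      _root_.ncard_diff_pair (S := {B | B ∈ U.lines ∧ x ∈ B}) ⟨hD, hxD⟩ ⟨hA, hxA⟩ hDA,
      ncard_lines_through (by omega)]
    obtain ⟨m, rfl⟩ : ∃ m, n = m + 2 := ⟨n - 2, by omega⟩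
    rw [show (m + 2) ^ 2 - 2 = (m + 2) * (m + 1) + m by
      rw [show (m + 2) ^ 2 = (m + 2) * (m + 1) + m + 2 by ring, Nat.add_sub_cancel]]
    simp
  · rintro B ⟨⟨hB, hxB⟩, hBDA, hco⟩
    simp only [Set.mem_insert_iff, Set.mem_singleton_iff, not_or] at hBDA
    simp only [NonCocircular, not_not] at hco
    obtain ⟨M₀, hM₀, hxM₀, hMD, hMA, hMB⟩ := hco
    obtain ⟨M, hM, hyM, hpar⟩ := exists_parallel hII hD hM₀ hxD hxM₀ (by rwa [Set.inter_comm])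
      hyD hyx
    have hAM := (hpar.2.2 A hA hxA).1 (by rwa [Set.inter_comm])
    have hBM := (hpar.2.2 B hB hxB).1 (by rwa [Set.inter_comm])
    have hxM := hpar.2.1.2
    refine ⟨M, ⟨⟨⟨hM, hyM, by rwa [Set.inter_comm]⟩, fun e => hxM ?_⟩, hBM⟩, ?_⟩
    · rw [Set.mem_singleton_iff.1 e]; exact hxD
    · rintro M' ⟨⟨⟨hM', hyM', hAM'⟩, hM'D⟩, hBM'⟩
      by_contra hne
      have hxM' : x ∉ M' := fun h => hM'D (U.eq_of_mem hM' hD hyx hyM' h hyD hxD)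
      exact hI.false_of_meet hA hB hM' hM (Ne.symm hBDA.2) hne hxA hxB hyM' hyM hyA
        (fun h => hBDA.1 (U.eq_of_mem hB hD hyx h hxB hyD hxD)) hxM' hxM
        (by rwa [Set.inter_comm]) hAM hBM' hBM
  · rintro M ⟨⟨hM, hyM, hAM⟩, hMD⟩
    have hxM : x ∉ M := fun h => hMD (U.eq_of_mem hM hD hyx hyM h hyD hxD)
    have hset : {B ∈ {B | (B ∈ U.lines ∧ x ∈ B) ∧ B ∉ ({D, A} : Set (Set P)) ∧
        ¬ U.NonCocircular x D A B} | (B ∩ M).Nonempty} = U.star x M \ {D, A} := by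
      ext B
      simp only [Set.mem_ofPred_eq, Set.mem_sdiff, star]
      constructor
      · rintro ⟨⟨h1, h2, -⟩, h3⟩
        exact ⟨⟨h1.1, h1.2, h3⟩, h2⟩
      · rintro ⟨⟨h1, h2, h3⟩, h4⟩
        exact ⟨⟨⟨h1, h2⟩, h4, fun hco => hco ⟨M, hM, hxM, ⟨y, hyM, hyD⟩, hAM,
          by rwa [Set.inter_comm]⟩⟩, h3⟩
    rw [hset, _root_.ncard_diff_pair (S := U.star x M) ⟨hD, hxD, y, hyD, hyM⟩
      ⟨hA, hxA, by rwa [Set.inter_comm]⟩ hDA, ncard_star hM hxM]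
    omega

/-- For `M` meeting a line `D` through `x` in a point `y ≠ x`, the parallels to `M` through `x`
with respect to the remaining points of `D`. -/
theorem exists_parallel_family (hI : U.ConditionI) (hII : U.ConditionII) (hn : 4 ≤ n) {x y : P}
    {D M : Set P} (hD : D ∈ U.lines) (hM : M ∈ U.lines) (hxD : x ∈ D) (hyD : y ∈ D)
    (hyM : y ∈ M) (hxM : x ∉ M) : ∃ f : P → Set P,
      (∀ z ∈ D \ {x, y}, x ∈ f z ∧ U.Parallel z (f z) M) ∧ Set.InjOn f (D \ {x, y}) := by
  have hMD : M ≠ D := fun e => hxM (e ▸ hxD)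
  have key : ∀ z ∈ D \ {x, y}, ∃ A, x ∈ A ∧ U.Parallel z A M := by
    rintro z ⟨hzD, hz⟩
    simp only [Set.mem_insert_iff, Set.mem_singleton_iff, not_or] at hz
    have hzM : z ∉ M := fun h => hz.2 (U.point_eq_of_mem hM hD hMD h hyM hzD hyD)
    obtain ⟨A, -, hxA, hA⟩ := exists_parallel hII hD hM hzD hzM ⟨y, hyD, hyM⟩ hxD (Ne.symm hz.1)
    exact ⟨A, hxA, hA.symm⟩
  choose! f hf using key
  refine ⟨f, hf, fun z hz w hw hzw => ?_⟩
  have h1 := hf z hz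
  have h2 := hf w hw
  rw [← hzw] at h2
  exact h1.2.center_unique hI h2.2 (h1.2.disjoint hn hI fun e => hxM (e ▸ h1.1)) hD h1.1 hyM hxD
    hyD hz.1 hw.1 hn

/-- Choose `M` with `B` in the family of parallels to `M` through `x`, centred on `D`. Any two
members are noncocircular with `D`, and the `n - 2` members other than `B` exhaust the lines
noncocircular with `D` and `B`. So `A` and `C` both belong to the family. -/
theorem NonCocircular.trans (hn : 4 ≤ n) (hI : U.ConditionI) (hII : U.ConditionII) {x : P}
    {D A B C : Set P} (hD : D ∈ U.lines) (hA : A ∈ U.lines) (hB : B ∈ U.lines) (hC : C ∈ U.lines)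
    (hxD : x ∈ D) (hxA : x ∈ A) (hxB : x ∈ B) (hxC : x ∈ C) (hDA : D ≠ A) (hDB : D ≠ B)
    (hDC : D ≠ C) (hAB : A ≠ B) (hBC : B ≠ C) (hAC : A ≠ C) (h : U.NonCocircular x D A B)
    (h' : U.NonCocircular x D B C) : U.NonCocircular x D A C := by
  obtain ⟨y, hyD, hyx⟩ : ∃ y ∈ D, y ≠ x :=
    Set.exists_ne_of_one_lt_ncard (by rw [U.card_line D hD]; omega) x
  have hcard : (D \ {x, y}).ncard = n - 1 := by
    rw [_root_.ncard_diff_pair hxD hyD hyx.symm, U.card_line D hD]; omega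
  obtain ⟨u, hu⟩ : (D \ {x, y}).Nonempty := (Set.ncard_pos).1 (by omega)
  have hu' := hu.2
  simp only [Set.mem_insert_iff, Set.mem_singleton_iff, not_or] at hu'
  have huB : u ∉ B := fun h => hDB (U.eq_of_mem hD hB hu'.1 hu.1 hxD h hxB)
  obtain ⟨M, hM, hyM, hBM⟩ := exists_parallel hII hD hB hu.1 huB ⟨x, hxD, hxB⟩ hyD (Ne.symm hu'.2)
  have hMD : M ≠ D := fun e => hBM.2.1.2 (e ▸ hu.1)
  have hxM : x ∉ M := fun h => hMD (U.eq_of_mem hM hD hyx hyM h hyD hxD)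
  obtain ⟨f, hf, hinj⟩ := exists_parallel_family hI hII hn hD hM hxD hyD hyM hxM
  have hfu : f u = B := ((hf u hu).2.trans hBM.symm).eq_of_mem hn hI (hf u hu).1 hxB
  have hfD : ∀ z ∈ D \ {x, y}, f z ≠ D := fun z hz e => (hf z hz).2.1.2 (e ▸ hz.1)
  have hbad : ∀ z ∈ D \ {x, y}, ∀ w ∈ D \ {x, y}, z ≠ w → U.NonCocircular x D (f z) (f w) :=
    fun z hz w hw hzw => nonCocircular_of_parallel hI hII hn hD hxD hyD hz.1 hw.1 hyx.symm hzw hyM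
      (hf z hz).1 (hf w hw).1 (hf z hz).2 (hf w hw).2
  have hall : ∀ A ∈ {A | (A ∈ U.lines ∧ x ∈ A) ∧ A ∉ ({D, B} : Set (Set P)) ∧
      U.NonCocircular x D B A}, ∃ z ∈ (D \ {x, y}) \ {u}, f z = A := fun A hA =>
    surjOn_of_injOn_of_ncard_le (T := {A | (A ∈ U.lines ∧ x ∈ A) ∧ A ∉ ({D, B} : Set (Set P)) ∧
      U.NonCocircular x D B A}) (fun z hz => ⟨⟨(hf z hz.1).2.1.1, (hf z hz.1).1⟩, by
        rintro (e | e)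
        · exact hfD z hz.1 e
        · exact hz.2 (hinj hz.1 hu (e.trans hfu.symm)),
        hfu ▸ hbad u hu z hz.1 (fun e => hz.2 e.symm)⟩)
      (hinj.mono Set.sdiff_subset) (by
        rw [ncard_nonCocircular hn hI hII hD hB hxD hxB hDB, Set.ncard_sdiff_singleton_of_mem hu,
          hcard]
        omega) hA
  obtain ⟨z, hz, rfl⟩ := hall A ⟨⟨hA, hxA⟩, by
    rintro (e | e)
    · exact hDA e.symm
    · exact hAB e, h.swap_right⟩
  obtain ⟨w, hw, rfl⟩ := hall C ⟨⟨hC, hxC⟩, by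
    rintro (e | e)
    · exact hDC e.symm
    · exact hBC e.symm, h'⟩
  exact hbad z hz.1 w hw.1 fun e => hAC (by rw [e])

instance (x : P) : Finite (U.Pencil x) := inferInstanceAs (Finite {K // K ∈ U.lines ∧ x ∈ K})

theorem blockOf_subset_of_mem (hn : 4 ≤ n) (hI : U.ConditionI) (hII : U.ConditionII) {x : P}
    {A B C : U.Pencil x} (hAB : A ≠ B) (hC : C ∈ U.blockOf x A B) (hCA : C ≠ A) :
    U.blockOf x A B ⊆ U.blockOf x A C := by
  rcases eq_or_ne C B with rfl | hCB
  · exact le_rfl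
  intro E hE
  have hC' := ((mem_blockOf.1 hC).resolve_left hCA).resolve_left hCB
  rw [mem_blockOf] at hE ⊢
  rcases eq_or_ne E A with rfl | hEA
  · exact .inl rfl
  rcases eq_or_ne E C with rfl | hEC
  · exact .inr (.inl rfl)
  rcases eq_or_ne E B with rfl | hEB
  · exact .inr (.inr hC'.swap_right)
  have hE' := (hE.resolve_left hEA).resolve_left hEB
  have aux : ∀ {K K' : U.Pencil x}, K ≠ K' → K.1 ≠ K'.1 := fun h e => h (Subtype.ext e)
  exact .inr (.inr (NonCocircular.trans hn hI hII A.2.1 C.2.1 B.2.1 E.2.1 A.2.2 C.2.2 B.2.2 E.2.2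
    (aux hCA.symm) (aux hAB) (aux hEA.symm) (aux hCB) (aux hEB.symm) (aux hEC.symm)
    hC'.swap_right hE'))

theorem blockOf_eq_of_mem_left (hn : 4 ≤ n) (hI : U.ConditionI) (hII : U.ConditionII) {x : P}
    {A B C : U.Pencil x} (hAB : A ≠ B) (hC : C ∈ U.blockOf x A B) (hCA : C ≠ A) :
    U.blockOf x A B = U.blockOf x A C := by
  have h := blockOf_subset_of_mem hn hI hII hAB hC hCA
  exact h.antisymm (blockOf_subset_of_mem hn hI hII hCA.symm
    (h (mem_blockOf.2 (.inr (.inl rfl)))) hAB.symm)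

theorem blockOf_eq_of_mem (hn : 4 ≤ n) (hI : U.ConditionI) (hII : U.ConditionII) {x : P}
    {A B C E : U.Pencil x} (hAB : A ≠ B) (hCE : C ≠ E) (hC : C ∈ U.blockOf x A B)
    (hE : E ∈ U.blockOf x A B) : U.blockOf x A B = U.blockOf x C E := by
  have key : ∀ {C E : U.Pencil x}, C ≠ E → C ≠ A → C ∈ U.blockOf x A B → E ∈ U.blockOf x A B →
      U.blockOf x A B = U.blockOf x C E := by
    intro C E hCE hCA hC hE
    have h1 := blockOf_eq_of_mem_left hn hI hII hAB hC hCA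
    rw [h1, blockOf_comm] at hE
    rw [h1, blockOf_comm A C]
    exact blockOf_eq_of_mem_left hn hI hII hCA hE hCE.symm
  rcases eq_or_ne C A with hCA | hCA
  · rw [blockOf_comm C E]
    exact key hCE.symm (fun h => hCE (hCA.trans h.symm)) hE hC
  · exact key hCE hCA hC hE

theorem ncard_circleOf {x : P} {M : Set P} (hM : M ∈ U.lines) (hx : x ∉ M) :
    (U.circleOf x M).ncard = n + 1 := by
  rw [circleOf, Set.ncard_image_of_injective _ (Option.some_injective _), ← ncard_image_val,
    ← ncard_star hM hx]
  congr 1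
  ext K
  simp only [star, Set.mem_ofPred_eq]
  constructor
  · rintro ⟨K, hK, rfl⟩
    exact ⟨K.2.1, K.2.2, hK⟩
  · rintro ⟨h1, h2, h3⟩
    exact ⟨⟨K, h1, h2⟩, h3, rfl⟩

theorem ncard_blockOf (hn : 4 ≤ n) (hI : U.ConditionI) (hII : U.ConditionII) {x : P}
    {A B : U.Pencil x} (hAB : A ≠ B) : (U.blockOf x A B).ncard = n := by
  have hAB' : A.1 ≠ B.1 := fun e => hAB (Subtype.ext e)
  have hset : Subtype.val '' (U.blockOf x A B) = {A.1, B.1} ∪ {C | (C ∈ U.lines ∧ x ∈ C) ∧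
      C ∉ ({A.1, B.1} : Set (Set P)) ∧ U.NonCocircular x A.1 B.1 C} := by
    ext C
    constructor
    · rintro ⟨C, hC, rfl⟩
      by_cases h : C.1 ∈ ({A.1, B.1} : Set (Set P))
      · exact .inl h
      · refine .inr ⟨C.2, h, ?_⟩
        rcases mem_blockOf.1 hC with rfl | rfl | hC
        · simp at h
        · simp at h
        · exact hC
    · rintro ((rfl | rfl) | ⟨h1, -, h2⟩)
      · exact ⟨A, mem_blockOf.2 (.inl rfl), rfl⟩
      · exact ⟨B, mem_blockOf.2 (.inr (.inl rfl)), rfl⟩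
      · exact ⟨⟨C, h1⟩, mem_blockOf.2 (.inr (.inr h2)), rfl⟩
  rw [← ncard_image_val, hset, Set.ncard_union_eq (Set.disjoint_right.2 fun C hC => hC.2.1),
    Set.ncard_pair hAB', ncard_nonCocircular hn hI hII A.2.1 B.2.1 A.2.2 B.2.2 hAB']
  omega

theorem existsUnique_circle_none (hn : 4 ≤ n) (hI : U.ConditionI) (hII : U.ConditionII) {x : P}
    {A B : U.Pencil x} (hAB : A ≠ B) :
    ∃! C, C ∈ U.circles x ∧ none ∈ C ∧ some A ∈ C ∧ some B ∈ C := by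
  refine ⟨insert none (some '' U.blockOf x A B), ⟨.inr ⟨A, B, hAB, rfl⟩, by simp,
    by simp [mem_blockOf], by simp [mem_blockOf]⟩, ?_⟩
  rintro C ⟨⟨M, -, -, rfl⟩ | ⟨L, L', hLL, rfl⟩, h1, h2, h3⟩
  · exact absurd h1 none_notMem_circleOf
  · rw [blockOf_eq_of_mem hn hI hII hLL hAB (by simpa using h2) (by simpa using h3)]

theorem existsUnique_circle_some (hn : 4 ≤ n) (hI : U.ConditionI) (hII : U.ConditionII) {x : P}
    {A B E : U.Pencil x} (hAB : A ≠ B) (hAE : A ≠ E) (hBE : B ≠ E) :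
    ∃! C, C ∈ U.circles x ∧ some A ∈ C ∧ some B ∈ C ∧ some E ∈ C := by
  have aux : ∀ {K K' : U.Pencil x}, K ≠ K' → K.1 ≠ K'.1 := fun h e => h (Subtype.ext e)
  have hblock : ∀ {L L' : U.Pencil x}, L ≠ L' → A ∈ U.blockOf x L L' → B ∈ U.blockOf x L L' →
      E ∈ U.blockOf x L L' →
      U.blockOf x L L' = U.blockOf x A B ∧ U.NonCocircular x A.1 B.1 E.1 := by
    intro L L' hLL hA hB hE
    have := blockOf_eq_of_mem hn hI hII hLL hAB hA hB
    rw [this, mem_blockOf] at hE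
    exact ⟨this, (hE.resolve_left hAE.symm).resolve_left hBE.symm⟩
  by_cases h : U.NonCocircular x A.1 B.1 E.1
  · refine ⟨insert none (some '' U.blockOf x A B), ⟨.inr ⟨A, B, hAB, rfl⟩, by simp [mem_blockOf],
      by simp [mem_blockOf], by simp [mem_blockOf, h]⟩, ?_⟩
    rintro C ⟨⟨M, hM, hx, rfl⟩ | ⟨L, L', hLL, rfl⟩, h1, h2, h3⟩
    · rw [some_mem_circleOf, Set.inter_comm] at h1 h2 h3
      exact (h ⟨M, hM, hx, h1, h2, h3⟩).elim
    · rw [(hblock hLL (by simpa using h1) (by simpa using h2) (by simpa using h3)).1]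
  · simp only [NonCocircular, not_not] at h
    obtain ⟨M, hM, hx, hA, hB, hE⟩ := h
    rw [Set.inter_comm] at hA hB hE
    refine ⟨U.circleOf x M, ⟨.inl ⟨M, hM, hx, rfl⟩, some_mem_circleOf.2 hA, some_mem_circleOf.2 hB,
      some_mem_circleOf.2 hE⟩, ?_⟩
    rintro C ⟨⟨M', hM', hx', rfl⟩ | ⟨L, L', hLL, rfl⟩, h1, h2, h3⟩
    · rw [some_mem_circleOf] at h1 h2 h3
      have hpar := parallel_of_three_meet hI hII A.2.1 B.2.1 E.2.1 A.2.2 B.2.2 E.2.2 (aux hAB)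
        (aux hAE) (aux hBE) hM hM' hx hx' hA hB hE h1 h2 h3
      simp only [circleOf]
      congr 1
      ext K
      exact (hpar.2.2 K.1 K.2.1 K.2.2).symm
    · refine absurd ⟨M, hM, hx, ?_, ?_, ?_⟩ (hblock hLL (by simpa using h1) (by simpa using h2)
        (by simpa using h3)).2 <;> rwa [Set.inter_comm]

theorem isInversivePlane_circles (hn : 4 ≤ n) (hI : U.ConditionI) (hII : U.ConditionII) (x : P) :
    IsInversivePlane n (U.circles x) where
  card_points := by
    rw [Finite.card_option, ← ncard_lines_through (U := U) (by omega) x]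
    rfl
  card_circle := by
    rintro C (⟨M, hM, hx, rfl⟩ | ⟨L, L', hLL, rfl⟩)
    · exact ncard_circleOf hM hx
    · rw [Set.ncard_insert_of_notMem (by simp),
        Set.ncard_image_of_injective _ (Option.some_injective _), ncard_blockOf hn hI hII hLL]
  existsUnique_circle := by
    rintro (_ | A) (_ | B) (_ | E) hAB hAE hBE
    · exact absurd rfl hAB
    · exact absurd rfl hAB
    · exact absurd rfl hAE
    · exact existsUnique_circle_none hn hI hII fun e => hBE (by rw [e])
    · exact absurd rfl hBE
    · refine (existsUnique_congr fun C => ?_).1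
        (existsUnique_circle_none hn hI hII (A := A) (B := E) fun e => hAE (by rw [e]))
      tauto
    · refine (existsUnique_congr fun C => ?_).1
        (existsUnique_circle_none hn hI hII (A := A) (B := B) fun e => hAB (by rw [e]))
      tauto
    · exact existsUnique_circle_some hn hI hII (fun e => hAB (by rw [e]))
        (fun e => hAE (by rw [e])) fun e => hBE (by rw [e])

end Unital

/-! ### Conjugate lines and their polar. -/

namespace Unital

variable {P : Type*} {n : ℕ} {U : Unital P n}

/-- `L` and `M` are disjoint lines that are parallel with respect to at least two points. -/
def Conj (U : Unital P n) (L M : Set P) : Prop :=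
  L ∈ U.lines ∧ M ∈ U.lines ∧ Disjoint L M ∧
    ∃ z w, z ≠ w ∧ U.Parallel z L M ∧ U.Parallel w L M

theorem Conj.symm {L M : Set P} (h : U.Conj L M) : U.Conj M L := by
  obtain ⟨hL, hM, hd, z, w, hzw, hz, hw⟩ := h
  exact ⟨hM, hL, hd.symm, z, w, hzw, hz.symm, hw.symm⟩

theorem Conj.disjoint {L M : Set P} (h : U.Conj L M) : Disjoint L M := h.2.2.1

theorem Conj.not_mem {L M : Set P} (h : U.Conj L M) {p : P} (hp : p ∈ L) : p ∉ M :=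
  Set.disjoint_left.1 h.disjoint hp

theorem nonempty_of_mem_lines {L : Set P} (hL : L ∈ U.lines) : L.Nonempty :=
  Set.nonempty_of_ncard_ne_zero (by rw [U.card_line L hL]; omega)

theorem ne_of_disjoint {L M : Set P} (hL : L ∈ U.lines) (h : Disjoint L M) : L ≠ M := by
  rintro rfl
  exact (nonempty_of_mem_lines hL).ne_empty (disjoint_self.1 h)

theorem Parallel.circleOf_eq {x : P} {M M' : Set P} (h : U.Parallel x M M') :
    U.circleOf x M = U.circleOf x M' := by
  simp only [circleOf]
  congr 1
  ext K
  exact h.2.2 K.1 K.2.1 K.2.2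

theorem parallel_of_circleOf_eq {x : P} {M M' : Set P} (hM : M ∈ U.lines) (hx : x ∉ M)
    (hM' : M' ∈ U.lines) (hx' : x ∉ M') (h : U.circleOf x M = U.circleOf x M') :
    U.Parallel x M M' := by
  refine ⟨⟨hM, hx⟩, ⟨hM', hx'⟩, fun K hK hxK => ?_⟩
  exact (some_mem_circleOf (A := ⟨K, hK, hxK⟩)).symm.trans
    ((Set.ext_iff.1 h _).trans some_mem_circleOf)

/-- If `C ≠ B` were a second common element, meeting `M` in `p`, then `zp` would meet `A` by
parallelism, as well as `B` and `C`. -/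
theorem circleOf_inter_blockOf_of_parallel {x y z : P} {M : Set P} {A B : U.Pencil x}
    (hAM : Disjoint A.1 M) (hyB : y ∈ B.1) (hyM : y ∈ M) (hz : U.Parallel z A.1 M)
    (hzB : z ∈ B.1) : U.circleOf x M ∩ insert none (some '' U.blockOf x A B) = {some B} := by
  obtain ⟨⟨-, hzA⟩, ⟨hM, hzM⟩, -⟩ := id hz
  have hxM : x ∉ M := Set.disjoint_left.1 hAM A.2.2
  have hMB : M ≠ B.1 := fun e => hzM (e ▸ hzB)
  refine Set.Subset.antisymm ?_ ?_
  · rintro (_ | C) ⟨h1, h2⟩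
    · exact (none_notMem_circleOf h1).elim
    · obtain ⟨p, hpC, hpM⟩ := some_mem_circleOf.1 h1
      replace h2 : C ∈ U.blockOf x A B := by simpa using h2
      by_contra hCB
      replace hCB : C ≠ B := fun e => hCB (by rw [e]; rfl)
      have hCB' : C.1 ≠ B.1 := fun e => hCB (Subtype.ext e)
      have hCA : C ≠ A := by
        rintro rfl
        exact Set.disjoint_left.1 hAM hpC hpM
      have hno := ((mem_blockOf.1 h2).resolve_left hCA).resolve_left hCB
      have hpB : p ∉ B.1 := fun hpB => hxM
        (U.point_eq_of_mem C.2.1 B.2.1 hCB' C.2.2 hpC B.2.2 hpB ▸ hpM)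
      obtain ⟨J, hJ, hzJ, hpJ⟩ := U.exists_line (p := z) (q := p) fun e => hzM (e ▸ hpM)
      have hxJ : x ∉ J := fun hxJ => hpB (U.eq_of_mem hJ B.2.1
        (ne_of_mem_of_not_mem A.2.2 hzA) hxJ hzJ B.2.2 hzB ▸ hpJ)
      exact hno ⟨J, hJ, hxJ, (hz.2.2 J hJ hzJ).2 ⟨p, hpJ, hpM⟩, ⟨z, hzJ, hzB⟩, ⟨p, hpJ, hpC⟩⟩
  · rintro _ rfl
    exact ⟨some_mem_circleOf.2 ⟨y, hyB, hyM⟩, by simp [mem_blockOf]⟩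

theorem left_mem_blockCircle {x : P} {A B : U.Pencil x} :
    some A ∈ (insert none (some '' U.blockOf x A B) : Set (U.InvPoint x)) :=
  .inr ⟨A, mem_blockOf.2 (.inl rfl), rfl⟩

theorem right_mem_blockCircle {x : P} {A B : U.Pencil x} :
    some B ∈ (insert none (some '' U.blockOf x A B) : Set (U.InvPoint x)) :=
  .inr ⟨B, mem_blockOf.2 (.inr (.inl rfl)), rfl⟩

theorem none_mem_blockCircle {x : P} {A B : U.Pencil x} :
    none ∈ (insert none (some '' U.blockOf x A B) : Set (U.InvPoint x)) := .inl rfl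

theorem blockCircle_mem_circles {x : P} {A B : U.Pencil x} (hAB : A ≠ B) :
    insert none (some '' U.blockOf x A B) ∈ U.circles x := .inr ⟨A, B, hAB, rfl⟩

theorem circleOf_mem_circles {x : P} {M : Set P} (hM : M ∈ U.lines) (hx : x ∉ M) :
    U.circleOf x M ∈ U.circles x := .inl ⟨M, hM, hx, rfl⟩

variable [Finite P]

/-- Each of the `n - 1` points `z` of `B` other than `x`, `y` gives a line through `x` that is
`z`-parallel to `M`, and its circle with `B` and `∞` is tangent at `B`. The tangent at `B` through
`∞` is unique, so these lines fill the block apart from `B` and include `A`. -/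
theorem exists_parallel_of_tangent (hn : 4 ≤ n) (hI : U.ConditionI) (hII : U.ConditionII)
    {x y : P} {M : Set P} {A B : U.Pencil x} (hM : M ∈ U.lines) (hAM : Disjoint A.1 M)
    (hyB : y ∈ B.1) (hyM : y ∈ M)
    (h : (U.circleOf x M ∩ insert none (some '' U.blockOf x A B)).ncard = 1) :
    ∃ z ∈ B.1, U.Parallel z A.1 M := by
  have hplane := isInversivePlane_circles hn hI hII x
  have hxM : x ∉ M := Set.disjoint_left.1 hAM A.2.2
  have hyx : y ≠ x := fun e => hxM (e ▸ hyM)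
  have hAB : A ≠ B := by
    rintro rfl
    exact Set.disjoint_left.1 hAM hyB hyM
  obtain ⟨f, hf, hinj⟩ := exists_parallel_family hI hII hn B.2.1 hM B.2.2 hyB hyM hxM
  have hB : some B ∈ U.circleOf x M := some_mem_circleOf.2 ⟨y, hyB, hyM⟩
  have hmaps : ∀ z ∈ B.1 \ {x, y}, f z ∈ Subtype.val '' (U.blockOf x A B) \ {B.1} := by
    intro z hz
    obtain ⟨hxf, hpar⟩ := hf z hz
    have hfM : f z ≠ M := fun e => hxM (e ▸ hxf)
    have hfB : f z ≠ B.1 := fun e => hpar.1.2 (e ▸ hz.1)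
    have hne : (⟨f z, hpar.1.1, hxf⟩ : U.Pencil x) ≠ B := fun e => hfB (by rw [← e])
    have h1 := circleOf_inter_blockOf_of_parallel (A := ⟨f z, hpar.1.1, hxf⟩)
      (hpar.disjoint hn hI hfM) hyB hyM hpar hz.1
    have heq := hplane.eq_of_tangent (by omega) (circleOf_mem_circles hM hxM)
      (blockCircle_mem_circles hAB) (blockCircle_mem_circles hne) (p := none) (u := some B)
      none_notMem_circleOf none_mem_blockCircle none_mem_blockCircle hB right_mem_blockCircle
      right_mem_blockCircle h
      (by rw [h1]; exact Set.ncard_singleton _)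
    obtain h2 | ⟨C, hC, hCf⟩ := (Set.ext_iff.1 heq _).2 left_mem_blockCircle
    · cases h2
    · exact ⟨⟨C, hC, by rw [Option.some_injective _ hCf]⟩, hfB⟩
  obtain ⟨z, hz, hzA⟩ := surjOn_of_injOn_of_ncard_le
    (T := Subtype.val '' (U.blockOf x A B) \ {B.1}) hmaps hinj (by
      have hBmem : B.1 ∈ Subtype.val '' (U.blockOf x A B) :=
        ⟨B, mem_blockOf.2 (.inr (.inl rfl)), rfl⟩
      rw [Set.ncard_sdiff_singleton_of_mem hBmem, ncard_image_val, ncard_blockOf hn hI hII hAB,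
        _root_.ncard_diff_pair B.2.2 hyB hyx.symm, U.card_line _ B.2.1]
      omega) (i := A.1) ⟨⟨A, mem_blockOf.2 (.inl rfl), rfl⟩, fun e => hAB (Subtype.ext e)⟩
  exact ⟨z, hz.1, hzA ▸ (hf z hz).2⟩

/-- Centres of parallelism correspond to tangent circles through `A` and `∞`, and distinct centres
lie on distinct lines through `x` by `Parallel.center_unique`. Since two tangents suffice, so do two
centres. -/
theorem isNucleus_circleOf_iff_conj (hn : 4 ≤ n) (he : Even n) (hI : U.ConditionI)
    (hII : U.ConditionII) {x : P} {A : U.Pencil x} {M : Set P} (hM : M ∈ U.lines) (hx : x ∉ M) :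
    IsInversivePlane.IsNucleus (U.circles x) (U.circleOf x M) (some A) none ↔ U.Conj A.1 M := by
  have hplane := isInversivePlane_circles hn hI hII x
  constructor
  · intro h
    have hAM : Disjoint A.1 M := Set.disjoint_left.2 fun p hp hp' =>
      h.left (some_mem_circleOf.2 ⟨p, hp, hp'⟩)
    have key : ∀ y ∈ M, ∃ B ∈ U.lines, x ∈ B ∧ y ∈ B ∧ ∃ z ∈ B, U.Parallel z A.1 M := by
      intro y hy
      obtain ⟨B, hB, hxB, hyB⟩ := U.exists_line (p := x) (q := y) fun e => hx (e ▸ hy)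
      have hAB : A ≠ ⟨B, hB, hxB⟩ := by
        intro e
        rw [e] at hAM
        exact Set.disjoint_left.1 hAM hyB hy
      obtain ⟨z, hz, hpar⟩ := exists_parallel_of_tangent hn hI hII (B := ⟨B, hB, hxB⟩) hM hAM hyB hy
        (h.tangent _ (blockCircle_mem_circles hAB) left_mem_blockCircle
          none_mem_blockCircle)
      exact ⟨B, hB, hxB, hyB, z, hz, hpar⟩
    obtain ⟨y₁, y₂, hy₁, hy₂, hne⟩ := (Set.one_lt_ncard_iff).1
      (show 1 < M.ncard by rw [U.card_line M hM]; omega)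
    obtain ⟨B₁, hB₁, hxB₁, hyB₁, z₁, hz₁, hp₁⟩ := key y₁ hy₁
    obtain ⟨B₂, hB₂, hxB₂, hyB₂, z₂, hz₂, hp₂⟩ := key y₂ hy₂
    refine ⟨A.2.1, hM, hAM, z₁, z₂, ?_, hp₁, hp₂⟩
    rintro rfl
    have hB : B₁ = B₂ := U.eq_of_mem hB₁ hB₂ (ne_of_mem_of_not_mem A.2.2 hp₁.1.2) hxB₁ hz₁ hxB₂ hz₂
    exact hx (U.eq_of_mem hB₁ hM hne hyB₁ (hB ▸ hyB₂) hy₁ hy₂ ▸ hxB₁)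
  · rintro ⟨hA, -, hAM, z₁, z₂, hne, hp₁, hp₂⟩
    have key : ∀ z, U.Parallel z A.1 M → ∃ B : U.Pencil x, A ≠ B ∧ z ∈ B.1 ∧ (∃ y ∈ B.1, y ∈ M) ∧
        U.circleOf x M ∩ insert none (some '' U.blockOf x A B) = {some B} := by
      intro z hz
      obtain ⟨B, hB, hxB, hzB⟩ := U.exists_line (p := x) (q := z) fun e => hz.1.2 (e ▸ A.2.2)
      obtain ⟨y, hyB, hyM⟩ := (hz.2.2 B hB hzB).1 ⟨x, hxB, A.2.2⟩
      refine ⟨⟨B, hB, hxB⟩, fun e => ?_, hzB, ⟨y, hyB, hyM⟩,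
        circleOf_inter_blockOf_of_parallel hAM hyB hyM hz hzB⟩
      rw [e] at hAM
      exact Set.disjoint_left.1 hAM hyB hyM
    obtain ⟨B₁, hAB₁, hz₁, ⟨y, hyB, hyM⟩, h₁⟩ := key z₁ hp₁
    obtain ⟨B₂, hAB₂, hz₂, -, h₂⟩ := key z₂ hp₂
    refine hplane.isNucleus_of_two_tangents (by omega) he (circleOf_mem_circles hM hx)
      (blockCircle_mem_circles hAB₁) (blockCircle_mem_circles hAB₂) (fun e => hne ?_) (by simp)
      (fun h => ?_) none_notMem_circleOf left_mem_blockCircle none_mem_blockCircle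
      left_mem_blockCircle none_mem_blockCircle (by rw [h₁]; exact Set.ncard_singleton _) (by rw [h₂]; exact Set.ncard_singleton _)
    · rw [e, h₂] at h₁
      have hB : B₂ = B₁ := Option.some_injective _ (Set.singleton_injective h₁)
      subst hB
      exact hp₁.center_unique hI hp₂ hAM B₂.2.1 A.2.2 hyM B₂.2.2 hyB hz₁ hz₂ hn
    · obtain ⟨p, hp, hp'⟩ := some_mem_circleOf.1 h
      exact Set.disjoint_left.1 hAM hp hp'

theorem exists_parallel_center (hn : 4 ≤ n) (he : Even n) (hI : U.ConditionI)
    (hII : U.ConditionII) {L M : Set P} (hL : L ∈ U.lines) (hM : M ∈ U.lines)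
    (hLM : Disjoint L M) : ∃ z, U.Parallel z L M := by
  obtain ⟨x, hxL⟩ := nonempty_of_mem_lines hL
  have hxM : x ∉ M := Set.disjoint_left.1 hLM hxL
  obtain ⟨E, hE, hnE, hAE, h1⟩ := (isInversivePlane_circles hn hI hII x).exists_tangent_through
    (by omega) he (circleOf_mem_circles hM hxM) (p := none) (v := some (⟨L, hL, hxL⟩ : U.Pencil x))
    (by simp) none_notMem_circleOf
  obtain ⟨B, hB⟩ := Set.ncard_eq_one.1 h1
  have hBmem : B ∈ U.circleOf x M ∩ E := by rw [hB]; rfl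
  rcases B with _ | B
  · exact (none_notMem_circleOf hBmem.1).elim
  obtain ⟨y, hyB, hyM⟩ := some_mem_circleOf.1 hBmem.1
  have hAB : (⟨L, hL, hxL⟩ : U.Pencil x) ≠ B := by
    rintro rfl
    exact Set.disjoint_left.1 hLM hyB hyM
  have heq := (existsUnique_circle_none hn hI hII hAB).unique ⟨hE, hnE, hAE, hBmem.2⟩
    ⟨blockCircle_mem_circles hAB, none_mem_blockCircle, left_mem_blockCircle, right_mem_blockCircle⟩
  rw [heq] at h1
  obtain ⟨z, -, hz⟩ := exists_parallel_of_tangent hn hI hII (A := ⟨L, hL, hxL⟩) hM hLM hyB hyM h1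
  exact ⟨z, hz⟩

theorem existsUnique_conj_through (hn : 4 ≤ n) (he : Even n) (hI : U.ConditionI)
    (hII : U.ConditionII) {M : Set P} (hM : M ∈ U.lines) {p : P} (hp : p ∉ M) :
    ∃! J, p ∈ J ∧ U.Conj J M := by
  have hplane := isInversivePlane_circles hn hI hII p
  have hC := circleOf_mem_circles hM hp
  obtain ⟨q, hq⟩ := hplane.exists_isNucleus (by omega) he hC none_notMem_circleOf
  rcases q with _ | J
  · exact (hq.ne rfl).elim
  refine ⟨J.1, ⟨J.2.2, (isNucleus_circleOf_iff_conj hn he hI hII hM hp).1 hq.symm⟩, ?_⟩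
  rintro J' ⟨hpJ', hJ'⟩
  have h := (isNucleus_circleOf_iff_conj hn he hI hII (A := ⟨J', hJ'.1, hpJ'⟩) hM hp).2 hJ'
  have := Option.some_injective _
    (IsInversivePlane.IsNucleus.unique hplane (by omega) hC hq h.symm)
  rw [this]

theorem Conj.eq_of_mem (hn : 4 ≤ n) (he : Even n) (hI : U.ConditionI) (hII : U.ConditionII)
    {J J' M : Set P} (h : U.Conj J M) (h' : U.Conj J' M) {p : P} (hp : p ∈ J) (hp' : p ∈ J') :
    J = J' :=
  (existsUnique_conj_through hn he hI hII h.2.1 (h.not_mem hp)).unique ⟨hp, h⟩ ⟨hp', h'⟩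

/-- In the plane at `z`, the lines `L` and `M` are the same circle. -/
theorem Conj.of_parallel (hn : 4 ≤ n) (he : Even n) (hI : U.ConditionI) (hII : U.ConditionII)
    {J L M : Set P} (h : U.Conj J L) {z : P} (hz : z ∈ J) (hp : U.Parallel z L M) :
    U.Conj J M := by
  have := (isNucleus_circleOf_iff_conj hn he hI hII (A := ⟨J, h.1, hz⟩) hp.1.1 hp.1.2).2 h
  rw [hp.circleOf_eq] at this
  exact (isNucleus_circleOf_iff_conj hn he hI hII (A := ⟨J, h.1, hz⟩) hp.2.1.1 hp.2.1.2).1 this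

/-- In the plane at `x`, both circles have nucleus pair `L`, `∞` and share the point `K`, so they
coincide. -/
theorem Conj.parallel_of_meet (hn : 4 ≤ n) (he : Even n) (hI : U.ConditionI)
    (hII : U.ConditionII) {L M M' K : Set P} (h : U.Conj L M) (h' : U.Conj L M') {x : P}
    (hx : x ∈ L) (hK : K ∈ U.lines) (hxK : x ∈ K) (hKM : (K ∩ M).Nonempty)
    (hKM' : (K ∩ M').Nonempty) : U.Parallel x M M' := by
  have hxM := h.not_mem hx
  have hxM' := h'.not_mem hx
  exact parallel_of_circleOf_eq h.2.1 hxM h'.2.1 hxM'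
    (IsInversivePlane.IsNucleus.eq_of_mem (isInversivePlane_circles hn hI hII x) (by omega) he
      (circleOf_mem_circles h.2.1 hxM) (circleOf_mem_circles h'.2.1 hxM')
      ((isNucleus_circleOf_iff_conj hn he hI hII (A := ⟨L, h.1, hx⟩) h.2.1 hxM).2 h)
      ((isNucleus_circleOf_iff_conj hn he hI hII (A := ⟨L, h.1, hx⟩) h'.2.1 hxM').2 h')
      (r := some ⟨K, hK, hxK⟩) (some_mem_circleOf.2 hKM) (some_mem_circleOf.2 hKM'))

/-- The points with respect to which two conjugate lines are parallel are the points of a line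
conjugate to both. -/
theorem Conj.exists_polar (hn : 4 ≤ n) (he : Even n) (hI : U.ConditionI) (hII : U.ConditionII)
    {L M : Set P} (h : U.Conj L M) : ∃ J, U.Conj L J ∧ U.Conj M J ∧
      (∀ p, U.Parallel p L M ↔ p ∈ J) ∧ ∀ x ∈ L, U.Parallel x M J := by
  obtain ⟨hL, hM, hLM, z, -, -, hz, -⟩ := id h
  -- The polar is the line through one centre `z` that is conjugate to `L`.
  obtain ⟨J, ⟨hzJ, hJL⟩, -⟩ := existsUnique_conj_through hn he hI hII hL hz.1.2
  have hJM := hJL.of_parallel hn he hI hII hzJ hz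
  have hMJ : ∀ x ∈ L, U.Parallel x M J := by
    intro x hx
    obtain ⟨K, hK, hxK, hzK⟩ := U.exists_line (p := x) (q := z) fun e => hz.1.2 (e ▸ hx)
    exact h.parallel_of_meet hn he hI hII hJL.symm hx hK hxK
      ((hz.2.2 K hK hzK).1 ⟨x, hxK, hx⟩) ⟨z, hzK, hzJ⟩
  have hJ : ∀ p ∈ J, U.Parallel p L M := fun p hp =>
    parallel_of_star_subset hL (hJL.not_mem hp) hM (hJM.not_mem hp) (by
      rintro K ⟨hK, hpK, x, hxK, hx⟩
      exact ⟨hK, hpK, ((hMJ x hx).2.2 K hK hxK).2 ⟨p, hpK, hp⟩⟩)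
  refine ⟨J, hJL.symm, hJM.symm, fun p => ⟨fun hp => ?_, hJ p⟩, hMJ⟩
  -- Conversely, join a centre `p` to a point of `L`. That line also meets `M` and `J`; its point on
  -- `J` is a centre too, hence equals `p`.
  obtain ⟨x, hx⟩ := nonempty_of_mem_lines hL
  obtain ⟨K, hK, hxK, hpK⟩ := U.exists_line (p := x) (q := p) fun e => hp.1.2 (e ▸ hx)
  obtain ⟨y, hyK, hyM⟩ := (hp.2.2 K hK hpK).1 ⟨x, hxK, hx⟩
  obtain ⟨w, hwK, hwJ⟩ := ((hMJ x hx).2.2 K hK hxK).1 ⟨y, hyK, hyM⟩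
  rw [hp.center_unique hI (hJ w hwJ) hLM hK hx hyM hxK hyK hpK hwK hn]
  exact hwJ

theorem conj_of_forall_parallel (hn : 4 ≤ n) {L M N : Set P} (hL : L ∈ U.lines) (hM : M ∈ U.lines)
    (hN : N ∈ U.lines) (hLM : Disjoint L M) (h : ∀ z ∈ N, U.Parallel z L M) : U.Conj L M := by
  obtain ⟨z, w, hz, hw, hzw⟩ := (Set.one_lt_ncard_iff).1
    (show 1 < N.ncard by rw [U.card_line N hN]; omega)
  exact ⟨hL, hM, hLM, z, w, hzw, h z hz, h w hw⟩

theorem Conj.exists_polar_eq (hn : 4 ≤ n) (he : Even n) (hI : U.ConditionI) (hII : U.ConditionII)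
    {L M N : Set P} (h : U.Conj L M) (hN : N ∈ U.lines) {z w : P} (hzN : z ∈ N) (hwN : w ∈ N)
    (hzw : z ≠ w) (hz : U.Parallel z L M) (hw : U.Parallel w L M) :
    (∀ p ∈ N, U.Parallel p L M) ∧ ∀ x ∈ L, U.Parallel x M N := by
  obtain ⟨J, hLJ, -, hJ, hMJ⟩ := h.exists_polar hn he hI hII
  obtain rfl : N = J := U.eq_of_mem hN hLJ.2.1 hzw hzN hwN ((hJ z).1 hz) ((hJ w).1 hw)
  exact ⟨fun p hp => (hJ p).2 hp, hMJ⟩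

theorem ncard_conj (hn : 4 ≤ n) (he : Even n) (hI : U.ConditionI) (hII : U.ConditionII)
    {L : Set P} (hL : L ∈ U.lines) : {J | U.Conj J L}.ncard = n ^ 2 - n := by
  have := ncard_eq_mul_of_existsUnique (S := Lᶜ) (T := {J | U.Conj J L})
    (r := fun J p => p ∈ J) (k := n + 1) ?_ ?_
  · rw [Set.ncard_compl, U.card_points, U.card_line L hL,
      show n ^ 3 + 1 - (n + 1) = (n ^ 2 - n) * (n + 1) by
        obtain ⟨m, rfl⟩ : ∃ m, n = m + 1 := ⟨n - 1, by omega⟩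
        rw [show (m + 1) ^ 2 = (m + 1) * m + (m + 1) by ring, Nat.add_sub_cancel,
          show (m + 1) ^ 3 + 1 = (m + 1) * m * (m + 1 + 1) + (m + 1 + 1) by ring,
          Nat.add_sub_cancel]] at this
    exact (Nat.eq_of_mul_eq_mul_right (by omega) this).symm
  · intro p hp
    obtain ⟨J, ⟨hpJ, hJ⟩, hu⟩ := existsUnique_conj_through hn he hI hII hL hp
    exact ⟨J, ⟨hJ, hpJ⟩, fun J' hJ' => hu J' ⟨hJ'.2, hJ'.1⟩⟩
  · intro J hJ
    rw [← U.card_line J hJ.1]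
    congr 1
    ext p
    exact ⟨fun h => h.2, fun h => ⟨Conj.not_mem hJ h, h⟩⟩

/-- Fix `p ∈ M`. Every line `M'` through `p` disjoint from `L` has a common conjugate with `L`.
These conjugates are distinct for distinct `M'`, and counting (`n ^ 2 - n - 1` on both sides) shows
that they are all the conjugates of `L` other than `M`. So a common conjugate of `L` and `M` comes
from some `M'`, which must be `M` itself. -/
theorem Conj.eq_of_conj (hn : 4 ≤ n) (he : Even n) (hI : U.ConditionI) (hII : U.ConditionII)
    {L M J N : Set P} (h : U.Conj L M) (hJL : U.Conj J L) (hJM : U.Conj J M) (hNL : U.Conj N L)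
    (hNM : U.Conj N M) : J = N := by
  obtain ⟨p, hp⟩ := nonempty_of_mem_lines h.2.1
  have hpL := h.symm.not_mem hp
  have key : ∀ M' ∈ {K | K ∈ U.lines ∧ p ∈ K} \ U.star p L,
      ∃ J, U.Conj J L ∧ U.Conj M' J := by
    rintro M' ⟨⟨hM', hpM'⟩, hstar⟩
    have hd : Disjoint L M' := Set.disjoint_left.2 fun q hq hq' => hstar ⟨hM', hpM', q, hq', hq⟩
    -- A single centre is enough here, so `M'` need not be conjugate to `L`.
    obtain ⟨z, hz⟩ := exists_parallel_center hn he hI hII h.1 hM' hd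
    obtain ⟨J, ⟨hzJ, hJ⟩, -⟩ := existsUnique_conj_through hn he hI hII h.1 hz.1.2
    exact ⟨J, hJ, (hJ.of_parallel hn he hI hII hzJ hz).symm⟩
  choose! f hf using key
  have hall : ∀ J ∈ {J | U.Conj J L} \ {M}, ∃ M' ∈ {K | K ∈ U.lines ∧ p ∈ K} \ U.star p L,
      f M' = J := fun J hJ => by
    refine surjOn_of_injOn_of_ncard_le (T := {J | U.Conj J L} \ {M})
      (fun M' hM' => ⟨(hf M' hM').1, fun e => ?_⟩) (fun M' hM' M'' hM'' e => ?_) ?_ hJ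
    · exact (hf M' hM').2.not_mem hM'.1.2 (Set.mem_singleton_iff.1 e ▸ hp)
    · exact Conj.eq_of_mem hn he hI hII (hf M' hM').2 (e ▸ (hf M'' hM'').2) hM'.1.2 hM''.1.2
    · have hsub : U.star p L ⊆ {K | K ∈ U.lines ∧ p ∈ K} := fun K hK => ⟨hK.1, hK.2.1⟩
      have hmem : M ∈ {J | U.Conj J L} := h.symm
      rw [Set.ncard_sdiff hsub, ncard_lines_through (by omega), ncard_star h.1 hpL,
        Set.ncard_sdiff_singleton_of_mem hmem, ncard_conj hn he hI hII h.1]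
      omega
  have hfM : ∀ J, U.Conj J L → U.Conj J M → J = f M := by
    intro J hJL hJM
    obtain ⟨M', hM', rfl⟩ := hall J ⟨hJL, fun e => ne_of_disjoint hJM.1 hJM.disjoint e⟩
    rw [Conj.eq_of_mem hn he hI hII (hf M' hM').2 hJM.symm hM'.1.2 hp]
  rw [hfM J hJL hJM, hfM N hNL hNM]

/-- Members of a flock with carriers `L`, `∞` have these as nucleus pair; conversely, all circles
with this nucleus pair form a flock, by existence and uniqueness through each point. -/
theorem specialSpread_eq (hn : 4 ≤ n) (he : Even n) (hI : U.ConditionI) (hII : U.ConditionII)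
    {x : P} {L : Set P} (hL : L ∈ U.lines) (hx : x ∈ L) :
    U.specialSpread x L = {L} ∪ {M | U.Conj L M} := by
  have hplane := isInversivePlane_circles hn hI hII x
  rw [specialSpread]
  congr 1
  ext M
  constructor
  · rintro ⟨hM, hxM, hL', F, hF, hMF⟩
    refine (isNucleus_circleOf_iff_conj hn he hI hII (A := ⟨L, hL'⟩) hM hxM).1 ?_
    refine hplane.isNucleus_of_mem_flock hn he hF.carriers_ne hF.subset_circles (fun a ha => ?_)
      (fun C hC a ha => ?_) hMF
    · rw [← hF.sUnion_eq] at ha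
      obtain ⟨C, hC, haC⟩ := ha
      refine ⟨C, ⟨hC, haC⟩, fun D hD => ?_⟩
      by_contra hne
      exact Set.disjoint_left.1 (hF.disjoint D hD.1 C hC hne) hD.2 haC
    · rw [← hF.sUnion_eq]
      exact ⟨C, hC, ha⟩
  · intro h
    refine ⟨h.2.1, h.not_mem hx, ⟨hL, hx⟩, {C | C ∈ U.circles x ∧
      IsInversivePlane.IsNucleus (U.circles x) C (some ⟨L, hL, hx⟩) none},
      ⟨by simp, fun C hC => hC.1, fun C hC D hD hne => ?_, ?_⟩,
      circleOf_mem_circles h.2.1 (h.not_mem hx),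
      (isNucleus_circleOf_iff_conj hn he hI hII (A := ⟨L, hL, hx⟩) h.2.1 (h.not_mem hx)).2 h⟩
    · exact Set.disjoint_left.2 fun r hr hr' => hne
        (IsInversivePlane.IsNucleus.eq_of_mem hplane (by omega) he hC.1 hD.1 hC.2 hD.2 hr hr')
    · ext r
      constructor
      · rintro ⟨C, hC, hr⟩ (rfl | rfl)
        · exact hC.2.left hr
        · exact hC.2.right hr
      · intro hr
        simp only [Set.mem_compl_iff, Set.mem_insert_iff, Set.mem_singleton_iff, not_or] at hr
        obtain ⟨C, hC, hrC, hN⟩ := hplane.exists_isNucleus_mem (by omega) he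
          (p := some ⟨L, hL, hx⟩) (q := none) (by simp) (Ne.symm hr.1) (Ne.symm hr.2)
        exact ⟨C, ⟨hC, hN⟩, hrC⟩

theorem insert_pair_eq_specialSpread_inter (hn : 4 ≤ n) (he : Even n) (hI : U.ConditionI)
    (hII : U.ConditionII) {x y : P} {L M N : Set P} (hx : x ∈ L) (hy : y ∈ M) (hLM : U.Conj L M)
    (hLN : U.Conj L N) (hMN : U.Conj M N) :
    {L, M, N} = U.specialSpread x L ∩ U.specialSpread y M := by
  rw [specialSpread_eq hn he hI hII hLM.1 hx, specialSpread_eq hn he hI hII hLM.2.1 hy]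
  ext J
  constructor
  · rintro (rfl | rfl | rfl)
    · exact ⟨.inl rfl, .inr hLM.symm⟩
    · exact ⟨.inr hLM, .inl rfl⟩
    · exact ⟨.inr hLN, .inr hMN⟩
  · rintro ⟨rfl | h1, h2⟩
    · exact .inl rfl
    · rcases h2 with rfl | h2
      · exact .inr (.inl rfl)
      · exact .inr (.inr (hLM.eq_of_conj hn he hI hII (Conj.symm h1) (Conj.symm h2) hLN.symm
          hMN.symm))

end Unital

/-- The points at which the special spreads are constructed may be picked arbitrarily. -/
theorem theorem2p2 {P : Type*} {n : ℕ} (hn : 4 ≤ n) (heven : Even n) (U : Unital P n)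
    (hI : U.ConditionI) (hII : U.ConditionII)
    (pick : Set P → P) (hpick : ∀ K ∈ U.lines, pick K ∈ K)
    (L M N : Set P) (hL : L ∈ U.lines) (hM : M ∈ U.lines) (hN : N ∈ U.lines)
    (hLM : Disjoint L M) (hLN : Disjoint L N) (hMN : Disjoint M N) :
    List.TFAE [
      U.IsSelfPolarTriangle pick L M N,
      ∀ z ∈ N, U.Parallel z L M,
      ∀ K ∈ U.lines,
        (((K ∩ L).Nonempty ∧ (K ∩ M).Nonempty) ∨ ((K ∩ L).Nonempty ∧ (K ∩ N).Nonempty) ∨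
          ((K ∩ M).Nonempty ∧ (K ∩ N).Nonempty)) →
        (K ∩ L).Nonempty ∧ (K ∩ M).Nonempty ∧ (K ∩ N).Nonempty,
      M ∈ U.specialSpread (pick L) L \ {L} ∧
        ∃ z₁ ∈ N, ∃ z₂ ∈ N, z₁ ≠ z₂ ∧ U.Parallel z₁ L M ∧ U.Parallel z₂ L M] := by
  have : Finite P := Nat.finite_of_card_ne_zero (by rw [U.card_points]; omega)
  have hneLM := Unital.ne_of_disjoint hL hLM
  have hneLN := Unital.ne_of_disjoint hL hLN
  have hneMN := Unital.ne_of_disjoint hM hMN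
  have hSL := Unital.specialSpread_eq hn heven hI hII hL (hpick L hL)
  have hSM := Unital.specialSpread_eq hn heven hI hII hM (hpick M hM)
  tfae_have 1 → 2 := by
    rintro ⟨-, -, h, -, -⟩
    rw [hSL, hSM] at h
    have hmem : M ∈ ({L, M, N} : Set (Set P)) := .inr (.inl rfl)
    rw [h] at hmem
    have hconj : U.Conj L M := hmem.1.resolve_left hneLM.symm
    -- The polar of `L` and `M` lies in both spreads and is neither `L` nor `M`, so it is `N`.
    obtain ⟨J, hLJ, hMJ, hJ, -⟩ := hconj.exists_polar hn heven hI hII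
    have hJmem : J ∈ ({L, M, N} : Set (Set P)) := by
      rw [h]; exact ⟨.inr hLJ, .inr hMJ⟩
    rcases hJmem with rfl | rfl | rfl
    · exact (Unital.ne_of_disjoint hL hLJ.disjoint rfl).elim
    · exact (Unital.ne_of_disjoint hM hMJ.disjoint rfl).elim
    · exact fun z hz => (hJ z).2 hz
  tfae_have 2 → 3 := by
    intro h
    have hconj := Unital.conj_of_forall_parallel hn hL hM hN hLM h
    obtain ⟨z, w, hz, hw, hzw⟩ := (Set.one_lt_ncard_iff).1
      (show 1 < N.ncard by rw [U.card_line N hN]; omega)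
    have h1 := (hconj.exists_polar_eq hn heven hI hII hN hz hw hzw (h z hz) (h w hw)).2
    rintro K hK (⟨⟨x, hxK, hx⟩, hKM⟩ | ⟨hKL, ⟨z, hzK, hz⟩⟩ | ⟨hKM, ⟨z, hzK, hz⟩⟩)
    · exact ⟨⟨x, hxK, hx⟩, hKM, ((h1 x hx).2.2 K hK hxK).1 hKM⟩
    · exact ⟨hKL, ((h z hz).2.2 K hK hzK).1 hKL, ⟨z, hzK, hz⟩⟩
    · exact ⟨((h z hz).2.2 K hK hzK).2 hKM, hKM, ⟨z, hzK, hz⟩⟩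
  -- Condition 3 is symmetric in the three lines, so each point of any one of them is a centre for
  -- the other two.
  have par : (∀ K ∈ U.lines,
        (((K ∩ L).Nonempty ∧ (K ∩ M).Nonempty) ∨ ((K ∩ L).Nonempty ∧ (K ∩ N).Nonempty) ∨
          ((K ∩ M).Nonempty ∧ (K ∩ N).Nonempty)) →
        (K ∩ L).Nonempty ∧ (K ∩ M).Nonempty ∧ (K ∩ N).Nonempty) →
      U.Conj L M ∧ U.Conj L N ∧ U.Conj M N ∧ ∀ z ∈ N, U.Parallel z L M := by
    intro h
    have hN' : ∀ z ∈ N, U.Parallel z L M := fun z hz =>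
      ⟨⟨hL, Set.disjoint_right.1 hLN hz⟩, ⟨hM, Set.disjoint_right.1 hMN hz⟩, fun K hK hzK =>
        ⟨fun h' => (h K hK (.inr (.inl ⟨h', z, hzK, hz⟩))).2.1,
          fun h' => (h K hK (.inr (.inr ⟨h', z, hzK, hz⟩))).1⟩⟩
    have hM' : ∀ z ∈ M, U.Parallel z L N := fun z hz =>
      ⟨⟨hL, Set.disjoint_right.1 hLM hz⟩, ⟨hN, Set.disjoint_left.1 hMN hz⟩, fun K hK hzK =>
        ⟨fun h' => (h K hK (.inl ⟨h', z, hzK, hz⟩)).2.2,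
          fun h' => (h K hK (.inr (.inr ⟨⟨z, hzK, hz⟩, h'⟩))).1⟩⟩
    have hL' : ∀ z ∈ L, U.Parallel z M N := fun z hz =>
      ⟨⟨hM, Set.disjoint_left.1 hLM hz⟩, ⟨hN, Set.disjoint_left.1 hLN hz⟩, fun K hK hzK =>
        ⟨fun h' => (h K hK (.inl ⟨⟨z, hzK, hz⟩, h'⟩)).2.2,
          fun h' => (h K hK (.inr (.inl ⟨⟨z, hzK, hz⟩, h'⟩))).2.1⟩⟩
    exact ⟨Unital.conj_of_forall_parallel hn hL hM hN hLM hN',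
      Unital.conj_of_forall_parallel hn hL hN hM hLN hM',
      Unital.conj_of_forall_parallel hn hM hN hL hMN hL', hN'⟩
  tfae_have 3 → 1 := by
    intro h
    obtain ⟨cLM, cLN, cMN, -⟩ := par h
    refine ⟨⟨hL, hM, hN⟩, ⟨hneLM, hneLN, hneMN⟩,
      Unital.insert_pair_eq_specialSpread_inter hn heven hI hII (hpick L hL) (hpick M hM) cLM cLN
        cMN, ?_, ?_⟩
    · rw [← Unital.insert_pair_eq_specialSpread_inter hn heven hI hII (hpick L hL) (hpick N hN) cLN
        cLM cMN.symm, Set.pair_comm]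
    · rw [← Unital.insert_pair_eq_specialSpread_inter hn heven hI hII (hpick M hM) (hpick N hN) cMN
        cLM.symm cLN.symm, Set.pair_comm N L, Set.insert_comm]
  tfae_have 3 → 4 := by
    intro h
    obtain ⟨cLM, -, -, hN'⟩ := par h
    obtain ⟨z, w, hz, hw, hzw⟩ := (Set.one_lt_ncard_iff).1
      (show 1 < N.ncard by rw [U.card_line N hN]; omega)
    rw [hSL]
    exact ⟨⟨.inr cLM, hneLM.symm⟩, z, hz, w, hw, hzw, hN' z hz, hN' w hw⟩
  tfae_have 4 → 2 := by
    rintro ⟨-, z, hz, w, hw, hzw, hpz, hpw⟩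
    -- The centres `z` and `w` lie on the polar and on `N`, so `N` is the polar.
    exact (Unital.Conj.exists_polar_eq hn heven hI hII
      ⟨hL, hM, hLM, z, w, hzw, hpz, hpw⟩ hN hz hw hzw hpz hpw).1
  tfae_finish
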